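/- Let $V$ be a closed isometric operator in a separable complex Hilbert space $H$ (its domain $D(V)$ is a linear subspace that need not be dense, $\|Vx\|=\|x\|$ for $x\in D(V)$, and the graph of $V$ is closed), and let $E$ denote the identity operator. Write $\mathbb D=\{|z|<1\}$ and $\mathbb T_e=\{z\in\mathbb C:|z|\ne1\}$. **Generalized resolvents.** A generalized resolvent of an isometric operator $V$ is a function $\mathbf R(V):\zeta\mapsto \mathbf R_\zeta(V)=P_H(E_{\widetilde H}-\zeta U)^{-1}|_H$, $\zeta\in\mathbb T_e$, where $U\supseteq V$ is a unitary operator in a separable Hilbert space $\widetilde H\supseteq H$ and $P_H$ is the orthogonal projection of $\widetilde H$ onto $H$. **Notation.** Put $M_\zeta=(E-\zeta V)D(V)$ for $\zeta\in\mathbb C$, $M_\infty=R(V)$ (the range of $V$), and $N_\zeta=H\ominus M_\zeta$. For subspaces $H_1,H_2$ of $H$, let $\mathcal S(H_1;H_2)$ be the set of all analytic operator-valued functions on $\mathbb D$ whose values are linear contractions from $H_1$ to $H_2$. Fix $z_0\in\mathbb D$, with the convention $1/\overline{z_0}=\infty$ if $z_0=0$, and put $$V_{z_0}=(V-\overline{z_0}E)(E-z_0V)^{-1},$$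 an isometric operator with domain $M_{z_0}$ and range $M_{1/\overline{z_0}}$. For a bounded linear operator $C:N_{z_0}\to N_{1/\overline{z_0}}$ such that the inverse below exists (in particular for every contraction $C$) put $$V^+_{z_0;C}=V_{z_0}\oplus C,\qquad V_{C}=V_{C;z_0}=(V^+_{z_0;C}+\overline{z_0}E)(E+z_0V^+_{z_0;C})^{-1}.$$ Then the following hold. 1. (Inin's formula.) The formula $$\mathbf R_\zeta(V)=\left[E-\zeta V_{C(\zeta);z_0}\right]^{-1},\qquad \zeta\in\mathbb D,$$ establishes a one-to-one correspondence between all generalized resolvents $\mathbf R(V)$ of $V$ and all functions $C\in\mathcal S(N_{z_0};N_{1/\overline{z_0}})$: for each generalized resolvent there is exactly one such $C$, and for each such $C$ exactly one generalized resolvent, for which the formula holds (in particular, the inverse exists and is a bounded operator defined on all of $H$). 2. The relation $$\mathbf R_{u}(V)=-\frac{z_0}{u-z_0}E+\frac{u(1-|z_0|^2)}{(u-z_0)(1-\overline{z_0}u)}\,\mathbf R_{\frac{u-z_0}{1-\overline{z_0}u}}(V_{z_0}),\qquad u\in\mathbb T_e\setminus\{0,z_0,1/\overline{z_0}\},$$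 establishes a one-to-one correspondence between all generalized resolvents of $V$ and all generalized resolvents of $V_{z_0}$. -/

import Mathlib

open scoped ComplexConjugate InnerProduct OnePoint

universe u

namespace IsometricResolvent

open Complex.UnitDisc

noncomputable section

variable {H : Type u} [NormedAddCommGroup H] [InnerProductSpace ℂ H]

/-- The identity operator `E`, with domain the whole space. -/
def E (H : Type u) [NormedAddCommGroup H] [InnerProductSpace ℂ H] : H →ₗ.[ℂ] H :=
  (LinearMap.id : H →ₗ[ℂ] H).toPMap ⊤

/-- The product `S T` of two partially defined operators, with its natural domain
`{x ∈ D(T) : T x ∈ D(S)}`. -/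
def product (S T : H →ₗ.[ℂ] H) : H →ₗ.[ℂ] H :=
  S.comp (T.domRestrict ((S.domain.comap T.toFun).map T.domain.subtype)) (by
    rintro ⟨x, hx⟩
    obtain ⟨y, hy, hyx⟩ := hx.1
    have h : T.domRestrict ((S.domain.comap T.toFun).map T.domain.subtype) ⟨x, hx⟩ = T y :=
      LinearPMap.domRestrict_apply hyx.symm
    rw [h]
    exact hy)

/-- The linear-fractional transform `T_z = (T - z̄ E) (E - z T)⁻¹`. -/
def moebius (z : ℂ) (T : H →ₗ.[ℂ] H) : H →ₗ.[ℂ] H :=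
  product (T - conj z • E H) (E H - z • T).inverse

/-- `V` is an isometric operator (on its domain, which need not be dense). -/
def IsIsometric (V : H →ₗ.[ℂ] H) : Prop :=
  ∀ x : V.domain, ‖V x‖ = ‖(x : H)‖

/-- `M_ζ(V) = (E - ζ V) D(V)` for `ζ ∈ ℂ`, and `M_∞(V) = R(V)`. -/
def M (V : H →ₗ.[ℂ] H) (ζ : OnePoint ℂ) : Submodule ℂ H :=
  ζ.elim (LinearMap.range V.toFun) (fun w => LinearMap.range (E H - w • V).toFun)

/-- The defect subspace `N_ζ(V) = H ⊖ M_ζ(V)`. -/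
def N (V : H →ₗ.[ℂ] H) (ζ : OnePoint ℂ) : Submodule ℂ H :=
  (M V ζ)ᗮ

/-- The point `1 / z̄` of the extended plane (`∞` if `z = 0`). -/
def reflect (z : ℂ) : OnePoint ℂ :=
  if z = 0 then ∞ else (((conj z)⁻¹ : ℂ) : OnePoint ℂ)

theorem moebius_domain_le (z : ℂ) (V : H →ₗ.[ℂ] H) :
    (moebius z V).domain ≤ M V (z : OnePoint ℂ) := by
  intro x hx
  have h : x ∈ (E H - z • V).inverse.domain := hx.2
  rw [LinearPMap.inverse_domain] at h
  exact h

/-- The operator `V⁺_{z;C} = V_z ⊕ C`, where `C` is a bounded operator from `N_z` to `N_{1/z̄}`. -/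
def plusExtension (V : H →ₗ.[ℂ] H) (z : ℂ) (C : N V z →L[ℂ] N V (reflect z)) : H →ₗ.[ℂ] H :=
  (moebius z V).sup ⟨N V z, (N V (reflect z)).subtype ∘ₗ C.toLinearMap⟩
    (LinearPMap.sup_h_of_disjoint _ _
      ((Submodule.orthogonal_disjoint (M V z)).mono_left (moebius_domain_le z V)))

/-- The orthogonal extension `V_{C;z} = (V⁺_{z;C} + z̄ E) (E + z V⁺_{z;C})⁻¹` of `V`. -/
def orthogonalExtension (V : H →ₗ.[ℂ] H) (z : ℂ) (C : N V z →L[ℂ] N V (reflect z)) :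
    H →ₗ.[ℂ] H :=
  product (plusExtension V z C + conj z • E H) (E H + z • plusExtension V z C).inverse

/-- The class `S(H₁; H₂)` of analytic functions in the unit disc whose values are contractions
from `H₁` to `H₂`. -/
def SchurClass (H₁ H₂ : Submodule ℂ H) : Set (Complex.UnitDisc → H₁ →L[ℂ] H₂) :=
  {F | (∃ G : ℂ → H₁ →L[ℂ] H₂, AnalyticOnNhd ℂ G (Metric.ball 0 1) ∧ ∀ ζ : 𝔻, G ζ = F ζ) ∧
    ∀ ζ : 𝔻, ‖F ζ‖ ≤ 1}

/-- The set `{ζ : |ζ| ≠ 1}`, on which generalized resolvents are defined. -/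
abbrev OffCircle : Type := {ζ : ℂ // ‖ζ‖ ≠ 1}

/-- The inclusion of the open unit disc in `{ζ : |ζ| ≠ 1}`. -/
def discPoint (ζ : 𝔻) : OffCircle := ⟨ζ, ζ.norm_ne_one⟩

/-- A unitary operator `U` in a separable Hilbert space `K` that contains `H` (through the
isometric embedding `J`) and such that `U` extends `V`. -/
structure UnitaryExtension (V : H →ₗ.[ℂ] H) where
  K : Type u
  [normedAddCommGroup : NormedAddCommGroup K]
  [innerProductSpace : InnerProductSpace ℂ K]
  [completeSpace : CompleteSpace K]
  [separableSpace : TopologicalSpace.SeparableSpace K]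
  J : H →ₗᵢ[ℂ] K
  U : K ≃ₗᵢ[ℂ] K
  extends_V : ∀ x : V.domain, U (J x) = J (V x)

attribute [instance] UnitaryExtension.normedAddCommGroup UnitaryExtension.innerProductSpace
  UnitaryExtension.completeSpace UnitaryExtension.separableSpace

/-- The function `ζ ↦ P_H (E - ζ U)⁻¹ |_H`, `|ζ| ≠ 1`. The adjoint of the embedding `J` is the
orthogonal projection of `K` onto `H`. -/
def UnitaryExtension.resolvent [CompleteSpace H] {V : H →ₗ.[ℂ] H} (W : UnitaryExtension V)
    (ζ : OffCircle) : H →L[ℂ] H :=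
  ContinuousLinearMap.adjoint W.J.toContinuousLinearMap ∘L
    Ring.inverse (1 - (ζ : ℂ) • (W.U : W.K →L[ℂ] W.K)) ∘L W.J.toContinuousLinearMap

/-- The set of all generalized resolvents of `V`. -/
def GeneralizedResolvents [CompleteSpace H] (V : H →ₗ.[ℂ] H) : Set (OffCircle → H →L[ℂ] H) :=
  Set.range fun W : UnitaryExtension V => W.resolvent

/-- `R = T⁻¹`: the operator `T` is a bijection of its domain onto the whole space, and its inverse
is the bounded operator `R`. -/
def IsInverse (R : H →L[ℂ] H) (T : H →ₗ.[ℂ] H) : Prop :=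
  (∀ h : H, ∃ hR : R h ∈ T.domain, T ⟨R h, hR⟩ = h) ∧ ∀ f : T.domain, R (T f) = f

/-- Inin's formula `R_ζ = (E - ζ V_{C(ζ);z₀})⁻¹` for all `ζ` in the unit disc. -/
def IninFormula (V : H →ₗ.[ℂ] H) (z₀ : 𝔻)
    (R : OffCircle → H →L[ℂ] H) (C : 𝔻 → N V (z₀ : ℂ) →L[ℂ] N V (reflect z₀)) : Prop :=
  ∀ ζ : 𝔻, IsInverse (R (discPoint ζ)) (E H - (ζ : ℂ) • orthogonalExtension V z₀ (C ζ))

/-- The relation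
`R_u = -z₀ / (u - z₀) E + u (1 - |z₀|²) / ((u - z₀) (1 - z̄₀ u)) Q_t`, `t = (u - z₀) / (1 - z̄₀ u)`,
for all `u` with `|u| ≠ 1` other than `0`, `z₀`, `1 / z̄₀`. -/
def MoebiusRelation (z₀ : 𝔻) (R Q : OffCircle → H →L[ℂ] H) : Prop :=
  ∀ u t : OffCircle, (u : ℂ) ≠ 0 → (u : ℂ) ≠ z₀ → 1 - conj (z₀ : ℂ) * u ≠ 0 →
    (t : ℂ) = (u - z₀) / (1 - conj (z₀ : ℂ) * u) →
    R u = (-(z₀ : ℂ) / (u - z₀)) • (1 : H →L[ℂ] H)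
      + ((u : ℂ) * (1 - (‖(z₀ : ℂ)‖ : ℂ) ^ 2)
          / (((u : ℂ) - z₀) * (1 - conj (z₀ : ℂ) * u))) • Q t

end

end IsometricResolvent

/-!
If `U` is unitary in `K ⊇ H`, the compressed resolvent `P_H (1 - ζ U)⁻¹ |_H` equals
`(1 - ζ S(ζ))⁻¹` on the disc, where `S` is the transfer function of `U`: it is analytic and
contractive, and its values extend `V` as soon as `U` does. Conversely, for an analytic contractive
`S` the function `F(ζ) = (1 - ζ S(ζ))⁻¹` satisfies `2 Re F ≥ 1`, so the Taylor coefficients of `F`,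
extended to negative indices by taking adjoints, form a positive Toeplitz kernel on `ℤ`: on circles
of radius `r < 1` they are Fourier coefficients of a positive function, and `r → 1`. The shift on
the reproducing kernel Hilbert space of this kernel is a unitary `U` with `P_H U ^ n |_H` equal to
the `n`-th coefficient. In particular `P_H U |_H = S(0)`, and `‖S(0) x‖ = ‖V x‖ = ‖x‖ = ‖U x‖` for
`x ∈ D(V)` forces `U x = V x`.

The Möbius transform turns contractive extensions of `V` into contractive extensions of `V_{z₀}`.
A contraction which is isometric on a closed subspace maps the orthogonal complement of that
subspace into the orthogonal complement of its image, so the latter extensions are exactly the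
operators `V_{z₀} ⊕ C` with a contraction `C`.

The second correspondence is `U ↦ U_{z₀}` in the same space `K`. Uniqueness holds because a
generalized resolvent is determined by its values on the disc, through `R(1 / ζ̄) = 1 - R(ζ)*`, and
is continuous there, so that finitely many missing points do no harm.
-/

namespace IsometricResolvent

open Complex Complex.UnitDisc Filter Topology

noncomputable section

section MoebiusTransform

variable {A : Type*} [Ring A] [Algebra ℂ A] {z : ℂ} {a : A}

/-- The linear-fractional transform `(a - z̄) (1 - z a)⁻¹` in a complex algebra, the everywhere
defined counterpart of `moebius`. It is only meaningful when `1 - z a` is invertible. -/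
def moebiusTransform (z : ℂ) (a : A) : A :=
  (a - conj z • 1) * Ring.inverse (1 - z • a)

theorem moebiusTransform_mul_one_sub_smul (h : IsUnit (1 - z • a)) :
    moebiusTransform z a * (1 - z • a) = a - conj z • 1 :=
  Ring.inverse_mul_cancel_right _ _ h

theorem one_sub_smul_moebiusTransform_mul (h : IsUnit (1 - z • a)) (t : ℂ) :
    (1 - t • moebiusTransform z a) * (1 - z • a) = (1 + t * conj z) • 1 - (t + z) • a := by
  rw [sub_mul, one_mul, smul_mul_assoc, moebiusTransform_mul_one_sub_smul h]
  module

theorem one_sub_norm_sq_ne_zero (hz : ‖z‖ ≠ 1) : 1 - (‖z‖ : ℂ) ^ 2 ≠ 0 := by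
  rw [sub_ne_zero, ne_comm]
  exact_mod_cast mt (pow_eq_one_iff_of_nonneg (norm_nonneg z) two_ne_zero).mp hz

theorem isUnit_one_sub_neg_smul_moebiusTransform (hz : ‖z‖ ≠ 1) (h : IsUnit (1 - z • a)) :
    IsUnit (1 - (-z) • moebiusTransform z a) := by
  have hscalar : IsUnit ((1 - (-z) • moebiusTransform z a) * (1 - z • a)) := by
    rw [one_sub_smul_moebiusTransform_mul h, neg_add_cancel, zero_smul, sub_zero, neg_mul,
      mul_conj', ← sub_eq_add_neg, ← Algebra.algebraMap_eq_smul_one]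
    exact (one_sub_norm_sq_ne_zero hz).isUnit.map (algebraMap ℂ A)
  exact (Units.isUnit_mul_units _ h.unit).mp hscalar

theorem moebiusTransform_neg_moebiusTransform (hz : ‖z‖ ≠ 1) (h : IsUnit (1 - z • a)) :
    moebiusTransform (-z) (moebiusTransform z a) = a := by
  have hmul : (moebiusTransform z a - conj (-z) • 1) * (1 - z • a)
      = a * (1 - (-z) • moebiusTransform z a) * (1 - z • a) := by
    rw [mul_assoc, one_sub_smul_moebiusTransform_mul h, sub_mul,
      moebiusTransform_mul_one_sub_smul h, smul_mul_assoc, one_mul, map_neg, neg_add_cancel,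
      zero_smul, sub_zero, mul_smul_comm, mul_one]
    module
  rw [moebiusTransform, eq_comm, Ring.eq_mul_inverse_iff_mul_eq _ _ _
    (isUnit_one_sub_neg_smul_moebiusTransform hz h)]
  exact (h.mul_right_cancel hmul).symm

theorem one_sub_smul_eq_smul_mul (hz : ‖z‖ ≠ 1) {u t : ℂ} (hzu : 1 - conj z * u ≠ 0)
    (htu : t = (u - z) / (1 - conj z * u)) (h : IsUnit (1 - z • a)) :
    1 - u • a = ((1 - conj z * u) / (1 - (‖z‖ : ℂ) ^ 2)) •
      ((1 - t • moebiusTransform z a) * (1 - z • a)) := by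
  have hscalar := one_sub_norm_sq_ne_zero hz
  have htu' : t * (1 - conj z * u) = u - z := (eq_div_iff hzu).mp htu
  rw [one_sub_smul_moebiusTransform_mul h]
  rw [← conj_mul'] at hscalar ⊢
  match_scalars <;> field_simp
  · linear_combination -conj z * htu'
  · linear_combination htu'

theorem inverse_one_sub_smul_eq (hz : ‖z‖ ≠ 1) {u t : ℂ} (huz : u ≠ z)
    (hzu : 1 - conj z * u ≠ 0) (htu : t = (u - z) / (1 - conj z * u)) (h : IsUnit (1 - z • a))
    (hu : IsUnit (1 - u • a)) (ht : IsUnit (1 - t • moebiusTransform z a)) :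
    Ring.inverse (1 - u • a) = (-z / (u - z)) • 1
      + (u * (1 - (‖z‖ : ℂ) ^ 2) / ((u - z) * (1 - conj z * u))) •
        Ring.inverse (1 - t • moebiusTransform z a) := by
  have huz' : u - z ≠ 0 := sub_ne_zero.mpr huz
  have hzu' : 1 - u * conj z ≠ 0 := mul_comm u _ ▸ hzu
  have hscalar := one_sub_norm_sq_ne_zero hz
  have hinverse : Ring.inverse (1 - t • moebiusTransform z a) * (1 - u • a)
      = ((1 - conj z * u) / (1 - (‖z‖ : ℂ) ^ 2)) • (1 - z • a) := by
    rw [one_sub_smul_eq_smul_mul hz hzu htu h, mul_smul_comm,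
      Ring.inverse_mul_cancel_left _ _ ht]
  rw [← one_mul (Ring.inverse (1 - u • a)), eq_comm, Ring.eq_mul_inverse_iff_mul_eq _ _ _ hu,
    add_mul, smul_mul_assoc, smul_mul_assoc, one_mul, hinverse]
  match_scalars <;> field_simp <;> ring

end MoebiusTransform

section Unitary

variable {A : Type*} [Ring A] [StarRing A] [Algebra ℂ A] [StarModule ℂ A] {z : ℂ} {u : A}

theorem moebiusTransform_mem_unitary (hu : u ∈ unitary A) (h : IsUnit (1 - z • u)) :
    moebiusTransform z u ∈ unitary A := by
  have hstar : star (1 - z • u) = 1 - conj z • star u := by simp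
  have hleft : star (u - conj z • 1) * (u - conj z • 1) = star (1 - z • u) * (1 - z • u) := by
    rw [hstar]
    simp only [star_sub, star_smul, star_one, sub_mul, mul_sub,
      Unitary.star_mul_self_of_mem hu, mul_one, one_mul, smul_mul_assoc, mul_smul_comm]
    simp only [RCLike.star_def, RingHomCompTriple.comp_apply, RingHom.id_apply]
    module
  have hunit : IsUnit (moebiusTransform z u) := by
    have hfactor : u - conj z • 1 = u * star (1 - z • u) := by
      rw [hstar, mul_sub, mul_one, mul_smul_comm, Unitary.mul_star_self_of_mem hu]
    rw [moebiusTransform, hfactor]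
    exact ((Unitary.isUnit_coe (U := ⟨u, hu⟩)).mul h.star).mul h.ringInverse
  rw [hunit.mem_unitary_iff_star_mul_self, moebiusTransform, star_mul, mul_assoc,
    ← mul_assoc (star (u - _)), hleft, mul_assoc, Ring.mul_inverse_cancel _ h, mul_one,
    ← star_mul, Ring.mul_inverse_cancel _ h, star_one]

theorem star_inverse_one_sub_inv_conj_smul (hu : u ∈ unitary A) (hz : z ≠ 0)
    (h : IsUnit (1 - z • u)) :
    star (Ring.inverse (1 - (conj z)⁻¹ • u)) = 1 - Ring.inverse (1 - z • u) := by
  have hfactor : star (1 - (conj z)⁻¹ • u) = -(z⁻¹ • star u) * (1 - z • u) := by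
    rw [mul_sub, mul_one, neg_mul, smul_mul_smul_comm, Unitary.star_mul_self_of_mem hu,
      inv_mul_cancel₀ hz]
    simp only [star_sub, star_one, star_smul, star_inv₀, RCLike.star_def,
      RingHomCompTriple.comp_apply, RingHom.id_apply, one_smul, sub_neg_eq_add]
    abel
  have hinverse : Ring.inverse (-(z⁻¹ • star u)) = -(z • u) :=
    Ring.inverse_unit ⟨-(z⁻¹ • star u), -(z • u),
      by simp [Unitary.star_mul_self_of_mem hu, hz],
      by simp [Unitary.mul_star_self_of_mem hu, hz]⟩
  rw [← Ring.inverse_star, hfactor, Ring.inverse_mul (Or.inr h), hinverse,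
    Ring.inverse_mul_eq_iff_eq_mul _ _ _ h, mul_sub, mul_one, Ring.mul_inverse_cancel _ h]
  abel

end Unitary

section Resolvent

variable {A : Type*} [NormedRing A] [NormedAlgebra ℂ A] [HasSummableGeomSeries A] {a : A} {z : ℂ}

theorem isUnit_one_sub_smul (ha : ‖a‖ ≤ 1) (hz : ‖z‖ < 1) : IsUnit (1 - z • a) := by
  refine isUnit_one_sub_of_norm_lt_one ?_
  rw [norm_smul]
  exact (mul_le_of_le_one_right (norm_nonneg z) ha).trans_lt hz

theorem analyticAt_ringInverse_comp {f : ℂ → A} (hf : AnalyticAt ℂ f z) (hz : IsUnit (f z)) :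
    AnalyticAt ℂ (fun w => Ring.inverse (f w)) z :=
  (show AnalyticAt ℂ Ring.inverse (f z) from analyticAt_inverse hz.unit).comp hf

theorem hasDerivAt_inverse_one_sub_smul {G : ℂ → A} (hG : DifferentiableAt ℂ G 0) :
    HasDerivAt (fun w => Ring.inverse (1 - w • G w)) (G 0) 0 := by
  have hsub : HasDerivAt (fun w : ℂ => 1 - w • G w) (-G 0) 0 := by
    simpa using ((hasDerivAt_id (0 : ℂ)).smul hG.hasDerivAt).const_sub (1 : A)
  have hinverse : HasFDerivAt Ring.inverse (-ContinuousLinearMap.mulLeftRight ℂ A 1 1)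
      (1 - (0 : ℂ) • G 0) := by
    simpa using hasFDerivAt_ringInverse (𝕜 := ℂ) (1 : Aˣ)
  simpa [Function.comp_def] using hinverse.comp_hasDerivAt 0 hsub

end Resolvent

section UnitaryResolvent

variable {A : Type*} [NormedRing A] [StarRing A] [CStarRing A] [NormedAlgebra ℂ A] [CompleteSpace A]
  {u : A} {z : ℂ}

theorem isUnit_one_sub_smul_of_mem_unitary (hu : u ∈ unitary A) (hz : ‖z‖ ≠ 1) :
    IsUnit (1 - z • u) := by
  rcases eq_or_ne z 0 with rfl | hz0
  · simp
  · have hresolvent : z⁻¹ ∉ spectrum ℂ u := fun h =>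
      hz (by simpa using spectrum.subset_circle_of_unitary hu h)
    have := (spectrum.notMem_iff.mp hresolvent).smul (Units.mk0 z hz0)
    simpa [Units.smul_def, smul_sub, Algebra.algebraMap_eq_smul_one, smul_smul, hz0] using this

end UnitaryResolvent

section Compression

theorem norm_coe_linearIsometryEquiv_le {K : Type*} [NormedAddCommGroup K] [InnerProductSpace ℂ K]
    (U : K ≃ₗᵢ[ℂ] K) : ‖(U : K →L[ℂ] K)‖ ≤ 1 :=
  U.toLinearIsometry.norm_toContinuousLinearMap_le

variable {H K : Type*} [NormedAddCommGroup H] [InnerProductSpace ℂ H] [CompleteSpace H]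
  [NormedAddCommGroup K] [InnerProductSpace ℂ K] [CompleteSpace K] (J : H →ₗᵢ[ℂ] K)

theorem coe_mem_unitary (U : K ≃ₗᵢ[ℂ] K) : (U : K →L[ℂ] K) ∈ unitary (K →L[ℂ] K) :=
  (Unitary.linearIsometryEquiv.symm U).2

theorem adjoint_apply_linearIsometry (x : H) : (J.toContinuousLinearMap†) (J x) = x :=
  ext_inner_right ℂ fun y => by
    rw [ContinuousLinearMap.adjoint_inner_left]
    exact J.inner_map_map x y

/-- The compression `J† A J` of an operator along an isometric embedding `J`. -/
def compression : (K →L[ℂ] K) →L[ℂ] H →L[ℂ] H :=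
  ContinuousLinearMap.compL ℂ H K H (J.toContinuousLinearMap†) ∘L
    (ContinuousLinearMap.compL ℂ H K K).flip J.toContinuousLinearMap

theorem compression_apply (A : K →L[ℂ] K) (x : H) :
    compression J A x = (J.toContinuousLinearMap†) (A (J x)) := rfl

theorem compression_one : compression J 1 = 1 :=
  ContinuousLinearMap.ext (adjoint_apply_linearIsometry J)

theorem compression_star (A : K →L[ℂ] K) : compression J (star A) = star (compression J A) := by
  refine ContinuousLinearMap.ext fun x => ext_inner_right ℂ fun y => ?_
  simp only [ContinuousLinearMap.star_eq_adjoint, compression_apply,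
    ContinuousLinearMap.adjoint_inner_left, ContinuousLinearMap.adjoint_inner_right,
    LinearIsometry.coe_toContinuousLinearMap]

end Compression

section TransferFunction

variable {H K : Type*} [NormedAddCommGroup H] [InnerProductSpace ℂ H] [CompleteSpace H]
  [NormedAddCommGroup K] [InnerProductSpace ℂ K] [CompleteSpace K] (J : H →ₗᵢ[ℂ] K)
  {T : K →L[ℂ] K} {z : ℂ}

/-- The orthogonal projection onto the orthogonal complement of the range of an isometric
embedding. -/
def rangeComplementProjection : K →L[ℂ] K :=
  1 - J.toContinuousLinearMap ∘L J.toContinuousLinearMap†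

theorem rangeComplementProjection_apply (w : K) :
    rangeComplementProjection J w = w - J ((J.toContinuousLinearMap†) w) := rfl

theorem adjoint_rangeComplementProjection (w : K) :
    (J.toContinuousLinearMap†) (rangeComplementProjection J w) = 0 := by
  rw [rangeComplementProjection_apply, map_sub, adjoint_apply_linearIsometry, sub_self]

theorem rangeComplementProjection_apply_linearIsometry (x : H) :
    rangeComplementProjection J (J x) = 0 := by
  rw [rangeComplementProjection_apply, adjoint_apply_linearIsometry, sub_self]

theorem norm_sq_add_smul_rangeComplementProjection (h : H) (a : ℂ) (w : K) :
    ‖J h + a • rangeComplementProjection J w‖ ^ 2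
      = ‖h‖ ^ 2 + ‖a‖ ^ 2 * ‖rangeComplementProjection J w‖ ^ 2 := by
  have horth : inner ℂ (J h) (a • rangeComplementProjection J w) = 0 := by
    have := ContinuousLinearMap.adjoint_inner_right J.toContinuousLinearMap h
      (rangeComplementProjection J w)
    rw [adjoint_rangeComplementProjection, inner_zero_right] at this
    rw [inner_smul_right]
    exact mul_eq_zero_of_right _ this.symm
  rw [sq, norm_add_sq_eq_norm_sq_add_norm_sq_of_inner_eq_zero _ _ horth, norm_smul, J.norm_map]
  ring

theorem norm_sq_eq_adjoint_add_rangeComplementProjection (w : K) :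
    ‖w‖ ^ 2 = ‖(J.toContinuousLinearMap†) w‖ ^ 2 + ‖rangeComplementProjection J w‖ ^ 2 := by
  simpa [rangeComplementProjection_apply] using
    norm_sq_add_smul_rangeComplementProjection J ((J.toContinuousLinearMap†) w) 1 w

theorem norm_rangeComplementProjection_mul_le (hT : ‖T‖ ≤ 1) :
    ‖rangeComplementProjection J * T‖ ≤ 1 := by
  refine ContinuousLinearMap.opNorm_le_bound _ zero_le_one fun w => ?_
  have hle : ‖rangeComplementProjection J (T w)‖ ≤ ‖T w‖ := by
    rw [← sq_le_sq₀ (norm_nonneg _) (norm_nonneg _),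
      norm_sq_eq_adjoint_add_rangeComplementProjection J (T w)]
    exact le_add_of_nonneg_left (sq_nonneg _)
  exact hle.trans (T.le_of_opNorm_le hT w)

/-- The transfer (characteristic) function `z ↦ J† T (1 - z Q T)⁻¹ J` of an operator `T` with
respect to an isometric embedding `J`, where `Q` is the projection onto the complement of the range
of `J`. For a contraction `T` it is determined by `J† (1 - z T)⁻¹ J = (1 - z S(z))⁻¹`. -/
def transferFunction (T : K →L[ℂ] K) (z : ℂ) : H →L[ℂ] H :=
  compression J (T * Ring.inverse (1 - z • (rangeComplementProjection J * T)))

theorem isUnit_one_sub_smul_rangeComplementProjection_mul (hT : ‖T‖ ≤ 1) (hz : ‖z‖ < 1) :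
    IsUnit (1 - z • (rangeComplementProjection J * T)) :=
  isUnit_one_sub_smul (norm_rangeComplementProjection_mul_le J hT) hz

theorem exists_transferFunction_apply_eq (hT : ‖T‖ ≤ 1) (hz : ‖z‖ < 1) (h : H) :
    ∃ y, y = J h + z • rangeComplementProjection J (T y) ∧
      transferFunction J T z h = (J.toContinuousLinearMap†) (T y) := by
  refine ⟨Ring.inverse (1 - z • (rangeComplementProjection J * T)) (J h), ?_, rfl⟩
  have := congr($(Ring.mul_inverse_cancel _
    (isUnit_one_sub_smul_rangeComplementProjection_mul J hT hz)) (J h))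
  exact sub_eq_iff_eq_add.mp this

theorem norm_transferFunction_le (hT : ‖T‖ ≤ 1) (hz : ‖z‖ < 1) : ‖transferFunction J T z‖ ≤ 1 := by
  refine ContinuousLinearMap.opNorm_le_bound _ zero_le_one fun h => ?_
  obtain ⟨y, hy, hS⟩ := exists_transferFunction_apply_eq J hT hz h
  rw [one_mul, ← sq_le_sq₀ (norm_nonneg _) (norm_nonneg _), hS]
  have hTy : ‖T y‖ ^ 2 ≤ ‖y‖ ^ 2 := by
    gcongr
    simpa using T.le_of_opNorm_le hT y
  have hnorm := norm_sq_add_smul_rangeComplementProjection J h z (T y)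
  rw [← hy] at hnorm
  have hsq := norm_sq_eq_adjoint_add_rangeComplementProjection J (T y)
  have hz2 : ‖z‖ ^ 2 ≤ 1 := pow_le_one₀ (norm_nonneg z) hz.le
  nlinarith [sq_nonneg ‖rangeComplementProjection J (T y)‖]

theorem analyticOnNhd_transferFunction (hT : ‖T‖ ≤ 1) :
    AnalyticOnNhd ℂ (transferFunction J T) (Metric.ball 0 1) := fun z hz =>
  ((compression J).analyticAt _).comp (analyticAt_const.mul
    (analyticAt_ringInverse_comp (analyticAt_const.sub (analyticAt_id.smul analyticAt_const))
      (isUnit_one_sub_smul_rangeComplementProjection_mul J hT (by simpa using hz))))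

theorem transferFunction_apply_of_apply_eq (hT : ‖T‖ ≤ 1) (hz : ‖z‖ < 1) {x y : H}
    (hxy : T (J x) = J y) : transferFunction J T z x = y := by
  have hfixed : (1 - z • (rangeComplementProjection J * T)) (J x) = J x := by
    simp [hxy, rangeComplementProjection_apply_linearIsometry]
  have hinverse := congr($(Ring.inverse_mul_cancel _
    (isUnit_one_sub_smul_rangeComplementProjection_mul J hT hz)) (J x))
  rw [mul_apply_eq_comp, hfixed] at hinverse
  rw [transferFunction, compression_apply, mul_apply_eq_comp, hinverse]
  exact (congrArg _ hxy).trans (adjoint_apply_linearIsometry J y)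

theorem compression_inverse_one_sub_smul (hT : ‖T‖ ≤ 1) (hz : ‖z‖ < 1) :
    compression J (Ring.inverse (1 - z • T)) = Ring.inverse (1 - z • transferFunction J T z) := by
  rw [← one_mul (Ring.inverse (1 - z • transferFunction J T z)),
    Ring.eq_mul_inverse_iff_mul_eq _ _ _
      (isUnit_one_sub_smul (norm_transferFunction_le J hT hz) hz)]
  ext h
  obtain ⟨y, hy, hS⟩ := exists_transferFunction_apply_eq J hT hz h
  have hTy : (1 - z • T) y = J ((1 - z • transferFunction J T z) h) := by
    have hexpand : y - z • rangeComplementProjection J (T y) = J h := sub_eq_of_eq_add hy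
    calc y - z • T y
        = y - z • rangeComplementProjection J (T y) - z • J ((J.toContinuousLinearMap†) (T y)) := by
          rw [rangeComplementProjection_apply]
          module
      _ = J (h - z • transferFunction J T z h) := by rw [hexpand, ← hS, map_sub, map_smul]
  have hinverse := congr($(Ring.inverse_mul_cancel _ (isUnit_one_sub_smul hT hz)) y)
  rw [mul_apply_eq_comp, hTy, one_apply_eq_self] at hinverse
  rw [mul_apply_eq_comp, compression_apply, hinverse, hy, map_add, map_smul,
    adjoint_rangeComplementProjection, adjoint_apply_linearIsometry, smul_zero, add_zero,
    one_apply_eq_self]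

end TransferFunction

section Fourier

open AddCircle MeasureTheory

variable {T : ℝ} [Fact (0 < T)]

theorem fourierCoeff_eq_of_hasSum {B : Type*} [NormedAddCommGroup B] [NormedSpace ℂ B]
    [CompleteSpace B] {b : ℤ → B} (hb : Summable fun n => ‖b n‖) {f : AddCircle T → B}
    (hf : ∀ x, HasSum (fun n => fourier n x • b n) (f x)) : fourierCoeff f = b := by
  have hbound (n : ℤ) (x : AddCircle T) : ‖fourier n x • b n‖ = ‖b n‖ := by
    rw [fourier_apply, norm_smul, Circle.norm_coe, one_mul]
  funext k
  have hintegral := hasSum_integral_of_dominated_convergence (μ := haarAddCircle (T := T))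
    (F := fun n x => fourier (-k) x • fourier n x • b n)
    (f := fun x => fourier (-k) x • f x) (fun n _ => ‖b n‖)
    (fun n => Continuous.aestronglyMeasurable (by fun_prop))
    (fun n => .of_forall fun x => by
      rw [norm_smul, hbound, fourier_apply, Circle.norm_coe, one_mul])
    (.of_forall fun _ => hb) (integrable_const _) (.of_forall fun x => (hf x).const_smul _)
  have hterm (n : ℤ) : ∫ x, fourier (-k) x • fourier n x • b n ∂haarAddCircle (T := T)
      = if n = k then b k else 0 := by
    have h := congr($(fourierCoeff_fourier (T := T) n) k)
    simp only [fourierCoeff, smul_eq_mul] at h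
    simp only [smul_smul, integral_smul_const, h, Pi.single_apply, eq_comm (a := k)]
    split_ifs with hk
    · rw [hk, one_smul]
    · rw [zero_smul]
  simp only [hterm] at hintegral
  exact hintegral.unique (hasSum_ite_eq k (b k))

variable {A : Type*} [CStarAlgebra A]

theorem star_fourierCoeff (f : AddCircle T → A) (n : ℤ) :
    star (fourierCoeff f n) = fourierCoeff (fun x => star (f x)) (-n) := by
  rw [fourierCoeff, fourierCoeff, ← starL'_apply ℝ,
    ← ContinuousLinearEquiv.integral_comp_comm]
  simp

theorem star_mul_fourierCoeff_mul {f : AddCircle T → A} (hf : Continuous f) (a b : A) (m n : ℤ) :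
    star a * fourierCoeff f (m - n) * b
      = ∫ t, star (fourier m t • a) * f t * (fourier n t • b) ∂haarAddCircle := by
  have hint : Integrable (fun t => fourier (-(m - n)) t • f t) haarAddCircle :=
    Continuous.integrable_of_hasCompactSupport (by fun_prop) (HasCompactSupport.of_compactSpace _)
  rw [fourierCoeff, ← integral_const_mul_of_integrable hint,
    ← integral_mul_const_of_integrable (hint.const_mul _)]
  refine integral_congr_ae (.of_forall fun t => ?_)
  simp only [neg_sub, sub_eq_add_neg n, fourier_add, fourier_neg, star_smul, smul_mul_assoc,
    mul_smul_comm, smul_smul, starRingEnd_apply]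

theorem posSemidef_circulant_fourierCoeff [PartialOrder A] [StarOrderedRing A]
    {f : AddCircle T → A} (hf : Continuous f) (hpos : ∀ x, 0 ≤ f x) :
    (Matrix.circulant (fourierCoeff f)).PosSemidef := by
  refine ⟨Matrix.IsHermitian.ext fun m n => ?_, fun v => ?_⟩
  · simp only [Matrix.circulant_apply, star_fourierCoeff, neg_sub,
      fun x => (IsSelfAdjoint.of_nonneg (hpos x)).star_eq]
  · let w (t : AddCircle T) : A := v.sum fun n a => fourier n t • a
    have hint (a b : A) (m n : ℤ) :
        Integrable (fun t => star (fourier m t • a) * f t * (fourier n t • b)) haarAddCircle :=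
      Continuous.integrable_of_hasCompactSupport (by fun_prop)
        (HasCompactSupport.of_compactSpace _)
    have hsum : (v.sum fun m a => v.sum fun n b => star a * fourierCoeff f (m - n) * b)
        = ∫ t, star (w t) * f t * w t ∂haarAddCircle := by
      simp only [w, Finsupp.sum, star_sum, Finset.sum_mul, Finset.mul_sum,
        star_mul_fourierCoeff_mul hf]
      rw [Finset.sum_comm, integral_finsetSum _ fun m _ =>
        integrable_finsetSum _ fun n _ => hint _ _ _ _]
      exact Finset.sum_congr rfl fun m _ =>
        (integral_finsetSum _ fun n _ => hint _ _ _ _).symm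
    simp only [Matrix.circulant_apply, hsum]
    exact integral_nonneg fun t => star_left_conjugate_nonneg (hpos t) _

end Fourier

section Herglotz

theorem summable_norm_pow_smul {B : Type*} [NormedAddCommGroup B] [NormedSpace ℂ B] {a : ℕ → B}
    {z w : ℂ} (ha : Summable fun n => w ^ n • a n) (hzw : ‖z‖ < ‖w‖) :
    Summable fun n => ‖z ^ n • a n‖ := by
  have hw : 0 < ‖w‖ := (norm_nonneg z).trans_lt hzw
  have hratio : ‖z‖ / ‖w‖ < 1 := (div_lt_one hw).mpr hzw
  have hgeom : Summable fun n => ‖(‖z‖ / ‖w‖) ^ n‖ :=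
    (summable_geometric_of_lt_one (by positivity) hratio).norm
  refine (hgeom.mul_tendsto_const (by simpa using ha.tendsto_cofinite_zero.norm)).congr fun n => ?_
  rw [norm_smul, norm_smul, norm_pow, norm_pow, div_pow]
  field_simp

variable {A : Type*} [CStarAlgebra A] {a : ℕ → A}

/-- The extension of a sequence of coefficients to the integers by `a (-n) = star (a n)`. -/
def hermitianExtension (a : ℕ → A) : ℤ → A
  | .ofNat n => a n
  | .negSucc n => star (a (n + 1))

theorem hermitianExtension_natCast (n : ℕ) : hermitianExtension a n = a n := rfl

theorem hermitianExtension_neg_natCast (ha : IsSelfAdjoint (a 0)) (n : ℕ) :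
    hermitianExtension a (-n) = star (a n) := by
  cases n with
  | zero => exact ha.star_eq.symm
  | succ n => rfl

theorem summable_norm_hermitianExtension (ha : IsSelfAdjoint (a 0)) (h : Summable fun n => ‖a n‖) :
    Summable fun n => ‖hermitianExtension a n‖ :=
  .of_nat_of_neg h (by simpa only [hermitianExtension_neg_natCast ha, norm_star] using h)

variable {T : ℝ}

theorem hasSum_fourier_smul_hermitianExtension (ha : IsSelfAdjoint (a 0)) {x : AddCircle T}
    {s : A} (h : HasSum (fun n : ℕ => fourier n x • a n) s) :
    HasSum (fun n : ℤ => fourier n x • hermitianExtension a n) (s + star s - a 0) := by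
  have hneg : HasSum (fun n : ℕ => fourier (-n) x • hermitianExtension a (-n)) (star s) := by
    simpa only [hermitianExtension_neg_natCast ha, fourier_neg, star_smul, starRingEnd_apply]
      using h.star
  have hzero : fourier 0 x • hermitianExtension a 0 = a 0 := by
    rw [fourier_zero, one_smul]
    rfl
  simpa only [hzero] using HasSum.of_nat_of_neg
    (f := fun n : ℤ => fourier n x • hermitianExtension a n) h hneg

variable [PartialOrder A] [StarOrderedRing A]

theorem posSemidef_circulant_hermitianExtension_of_summable [Fact (0 < T)]
    (ha : IsSelfAdjoint (a 0)) (hsum : Summable fun n => ‖a n‖) {s : AddCircle T → A}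
    (hs : ∀ x, HasSum (fun n : ℕ => fourier n x • a n) (s x))
    (hpos : ∀ x, a 0 ≤ s x + star (s x)) :
    (Matrix.circulant (hermitianExtension a)).PosSemidef := by
  have hcont : Continuous s := by
    rw [← funext fun x => (hs x).tsum_eq]
    refine continuous_tsum (fun n => by fun_prop) hsum fun n x => ?_
    rw [fourier_apply, norm_smul, Circle.norm_coe, one_mul]
  have hnorm : Summable fun n => ‖hermitianExtension a n‖ :=
    summable_norm_hermitianExtension ha hsum
  have hcoeff : fourierCoeff (fun x => s x + star (s x) - a 0) = hermitianExtension a :=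
    fourierCoeff_eq_of_hasSum hnorm fun x => hasSum_fourier_smul_hermitianExtension ha (hs x)
  rw [← hcoeff]
  refine posSemidef_circulant_fourierCoeff ?_ fun x => sub_nonneg.mpr (hpos x)
  exact (hcont.add hcont.star).sub continuous_const

theorem isClosed_setOf_posSemidef (n : Type*) : IsClosed {M : Matrix n n A | M.PosSemidef} := by
  simp only [Matrix.PosSemidef, Matrix.IsHermitian, Set.ofPred_and, Set.ofPred_forall, Finsupp.sum]
  refine (isClosed_eq (by fun_prop) continuous_id).inter
    (isClosed_iInter fun x => isClosed_le continuous_const ?_)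
  fun_prop

theorem posSemidef_circulant_hermitianExtension {F : ℂ → A}
    (hF : ∀ z, ‖z‖ < 1 → HasSum (fun n => z ^ n • a n) (F z))
    (hpos : ∀ z, ‖z‖ < 1 → a 0 ≤ F z + star (F z)) :
    (Matrix.circulant (hermitianExtension a)).PosSemidef := by
  have ha : IsSelfAdjoint (a 0) := by
    have hF0 : F 0 = a 0 := (hF 0 (by simp)).unique (.hasSum_at_zero a)
    have h0 := hpos 0 (by simp)
    rw [hF0, le_add_iff_nonneg_right] at h0
    exact IsSelfAdjoint.star_iff.mp (.of_nonneg h0)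
  let M (r : ℝ) : Matrix ℤ ℤ A := .circulant (hermitianExtension fun n => (r : ℂ) ^ n • a n)
  have hM : Continuous M := continuous_matrix fun i j => by
    simp only [M, Matrix.circulant_apply]
    cases i - j <;> simp only [hermitianExtension] <;> fun_prop
  have hlim : Tendsto M (𝓝[<] 1) (𝓝 (.circulant (hermitianExtension a))) := by
    simpa [M] using (hM.tendsto 1).mono_left nhdsWithin_le_nhds
  refine (isClosed_setOf_posSemidef ℤ).mem_of_tendsto hlim ?_
  filter_upwards [Ioo_mem_nhdsLT (zero_lt_one (α := ℝ))] with r ⟨hr0, hr1⟩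
  obtain ⟨R, hrR, hR1⟩ := exists_between hr1
  have hnorm (x : UnitAddCircle) : ‖(r : ℂ) * fourier 1 x‖ < 1 := by
    rwa [norm_mul, fourier_apply, Circle.norm_coe, mul_one, norm_real, Real.norm_of_nonneg hr0.le]
  have hRnorm : ‖(R : ℂ)‖ < 1 := by
    rwa [norm_real, Real.norm_of_nonneg (hr0.trans hrR).le]
  have hrRnorm : ‖(r : ℂ)‖ < ‖(R : ℂ)‖ := by
    rwa [norm_real, norm_real, Real.norm_of_nonneg hr0.le,
      Real.norm_of_nonneg (hr0.trans hrR).le]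
  refine posSemidef_circulant_hermitianExtension_of_summable (T := 1) (by simpa using ha)
    (summable_norm_pow_smul (hF R hRnorm).summable hrRnorm) (s := fun x => F (r * fourier 1 x))
    (fun x => ?_) fun x => by simpa using hpos _ (hnorm x)
  have hpow (n : ℕ) : fourier (n : ℤ) x = fourier 1 x ^ n := by
    simp only [fourier_apply, natCast_zsmul, AddCircle.toCircle_nsmul, Circle.coe_pow, one_smul]
  have hsum := hF _ (hnorm x)
  simpa only [hpow, smul_smul, mul_comm, mul_pow] using hsum

end Herglotz

section Dilation

open RKHS

theorem exists_linearIsometryEquiv_of_inner_eq {ι K K' : Type*} [NormedAddCommGroup K]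
    [InnerProductSpace ℂ K] [CompleteSpace K] [NormedAddCommGroup K'] [InnerProductSpace ℂ K']
    [CompleteSpace K'] {k : ι → K} {k' : ι → K'}
    (hk : DenseRange (Finsupp.linearCombination ℂ k))
    (hk' : DenseRange (Finsupp.linearCombination ℂ k'))
    (h : ∀ i j, inner ℂ (k' i) (k' j) = inner ℂ (k i) (k j)) :
    ∃ U : K ≃ₗᵢ[ℂ] K', ∀ i, U (k i) = k' i := by
  have hnorm (x : ι →₀ ℂ) :
      ‖Finsupp.linearCombination ℂ k' x‖ = ‖Finsupp.linearCombination ℂ k x‖ := by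
    rw [@norm_eq_sqrt_re_inner ℂ, @norm_eq_sqrt_re_inner ℂ]
    simp only [Finsupp.linearCombination_apply, Finsupp.sum_inner, Finsupp.inner_sum,
      inner_smul_left, inner_smul_right, h]
  refine ⟨(LinearEquiv.refl ℂ (ι →₀ ℂ)).extendOfIsometry (Finsupp.linearCombination ℂ k)
    (Finsupp.linearCombination ℂ k') hk hk' hnorm, fun i => ?_⟩
  simpa using (LinearEquiv.refl ℂ (ι →₀ ℂ)).extendOfIsometry_eq (Finsupp.linearCombination ℂ k)
    (Finsupp.linearCombination ℂ k') hk hk' hnorm (Finsupp.single i 1)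

section ReproducingKernel

variable {X V K : Type*} [NormedAddCommGroup V] [InnerProductSpace ℂ V] [CompleteSpace V]
  [NormedAddCommGroup K] [InnerProductSpace ℂ K] [CompleteSpace K]
  [RKHS ℂ K X V]

theorem range_uncurry_kerFun :
    Set.range (fun p : X × V => kerFun K p.1 p.2) = {kerFun K x v | (x) (v)} := by
  ext
  simp

theorem denseRange_linearCombination_kerFun :
    DenseRange (Finsupp.linearCombination ℂ fun p : X × V => kerFun K p.1 p.2) := by
  rw [DenseRange, ← LinearMap.coe_range, Finsupp.range_linearCombination, range_uncurry_kerFun]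
  exact Submodule.dense_iff_topologicalClosure_eq_top.mpr (kerFun_dense K)

variable (K) in
theorem separableSpace_of_countable [Countable X] [TopologicalSpace.SeparableSpace V] :
    TopologicalSpace.SeparableSpace K := by
  let _ : TopologicalSpace X := ⊥
  have : DiscreteTopology X := ⟨rfl⟩
  have hcont : Continuous fun p : X × V => kerFun K p.1 p.2 :=
    continuous_prod_of_discrete_left.mpr fun x => (kerFun K x).continuous
  have hsep := ((TopologicalSpace.isSeparable_range hcont).span (R := ℂ)).closure
  rw [range_uncurry_kerFun, ← Submodule.topologicalClosure_coe, kerFun_dense] at hsep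
  exact TopologicalSpace.isSeparable_univ_iff.mp hsep

theorem exists_linearIsometryEquiv_kerFun_add [AddGroup X] {c : X → V →L[ℂ] V}
    (hc : kernel K = Matrix.circulant c) (g : X) :
    ∃ U : K ≃ₗᵢ[ℂ] K, ∀ x v, U (kerFun K x v) = kerFun K (x + g) v := by
  have hdense := denseRange_linearCombination_kerFun (K := K) (X := X) (V := V)
  have hdense' : DenseRange (Finsupp.linearCombination ℂ
      fun p : X × V => kerFun K (p.1 + g) p.2) := by
    rw [DenseRange, ← LinearMap.coe_range, Finsupp.range_linearCombination] at hdense ⊢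
    rwa [← ((Equiv.addRight g).prodCongr (.refl V)).surjective.range_comp] at hdense
  obtain ⟨U, hU⟩ := exists_linearIsometryEquiv_of_inner_eq hdense hdense' fun p q => by
    rw [← kernel_inner, ← kernel_inner, hc, Matrix.circulant_apply, Matrix.circulant_apply,
      add_sub_add_right_eq_sub]
  exact ⟨U, fun x v => hU (x, v)⟩

end ReproducingKernel

theorem exists_unitaryExtension_compression_pow {H : Type u} [NormedAddCommGroup H]
    [InnerProductSpace ℂ H] [CompleteSpace H] [TopologicalSpace.SeparableSpace H]
    {c : ℤ → H →L[ℂ] H} (hc : (Matrix.circulant c).PosSemidef) (h0 : c 0 = 1) :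
    ∃ W : UnitaryExtension (⊥ : H →ₗ.[ℂ] H), ∀ n : ℕ,
      compression W.J ((W.U : W.K →L[ℂ] W.K) ^ n) = c n := by
  have : Fact (Matrix.circulant c).PosSemidef := ⟨hc⟩
  let K := OfKernel (Matrix.circulant c)
  have hkernel : kernel K = Matrix.circulant c := OfKernel.kernel_ofKernel
  have hinner (m n : ℤ) (x y : H) :
      inner ℂ (kerFun K m x) (kerFun K n y) = inner ℂ (c (n - m) x) y := by
    rw [← kernel_inner, hkernel, Matrix.circulant_apply]
  have : TopologicalSpace.SeparableSpace K := separableSpace_of_countable K (X := ℤ) (V := H)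
  let J : H →ₗᵢ[ℂ] K := (kerFun K (0 : ℤ)).toLinearMap.isometryOfInner fun x y => by
    rw [ContinuousLinearMap.coe_coe, hinner, sub_self, h0, one_apply_eq_self]
  obtain ⟨U, hU⟩ := exists_linearIsometryEquiv_kerFun_add hkernel (-1)
  have hpow (n : ℕ) (x : H) : ((U : K →L[ℂ] K) ^ n) (J x) = kerFun K (-n : ℤ) x := by
    induction n with
    | zero => simp [J]
    | succ n ih =>
      rw [pow_succ', mul_apply_eq_comp, ih]
      exact (hU _ _).trans (by rw [← neg_add, Nat.cast_succ])
  refine ⟨⟨K, J, U, ?_⟩, fun n => ContinuousLinearMap.ext fun x => ext_inner_right ℂ fun y => ?_⟩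
  · intro x
    obtain rfl : x = 0 := Subtype.ext x.2
    rw [LinearPMap.map_zero, Submodule.coe_zero, map_zero, map_zero]
  · rw [compression_apply, ContinuousLinearMap.adjoint_inner_left, hpow]
    exact (hinner _ _ x y).trans (by simp)

end Dilation

section PositiveRealPart

variable {A : Type*} [CStarAlgebra A] [PartialOrder A] [StarOrderedRing A]

theorem one_le_inverse_one_sub_add_star {t : A} (ht : ‖t‖ ≤ 1) (h : IsUnit (1 - t)) :
    1 ≤ Ring.inverse (1 - t) + star (Ring.inverse (1 - t)) := by
  set r := Ring.inverse (1 - t)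
  have hr : r * t = r - 1 := by
    have := Ring.inverse_mul_cancel _ h
    rw [mul_sub, mul_one] at this
    rw [← this, sub_sub_cancel]
  have hle : t * star t ≤ 1 := by
    rw [← CStarAlgebra.norm_le_one_iff_of_nonneg _ (mul_star_self_nonneg t),
      CStarRing.norm_self_mul_star]
    exact mul_le_one₀ ht (norm_nonneg t) ht
  have hidentity : r + star r - 1 = r * (1 - t * star t) * star r := by
    rw [mul_sub, mul_one, ← mul_assoc, hr, sub_mul, mul_assoc, ← star_mul, hr, star_sub, star_one]
    noncomm_ring
  rw [← sub_nonneg, hidentity]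
  exact star_right_conjugate_nonneg (sub_nonneg.mpr hle) r

end PositiveRealPart

section Realization

variable {H : Type u} [NormedAddCommGroup H] [InnerProductSpace ℂ H] [CompleteSpace H]
  {V : H →ₗ.[ℂ] H}

theorem coe_discPoint (ζ : 𝔻) : (discPoint ζ : ℂ) = ζ := rfl

theorem UnitaryExtension.resolvent_eq_compression (W : UnitaryExtension V) (ζ : OffCircle) :
    W.resolvent ζ = compression W.J (Ring.inverse (1 - (ζ : ℂ) • (W.U : W.K →L[ℂ] W.K))) := rfl

theorem UnitaryExtension.resolvent_discPoint (W : UnitaryExtension V) (ζ : 𝔻) :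
    W.resolvent (discPoint ζ) = Ring.inverse (1 - (ζ : ℂ) • transferFunction W.J W.U ζ) :=
  compression_inverse_one_sub_smul W.J (norm_coe_linearIsometryEquiv_le W.U) ζ.norm_lt_one

theorem exists_unitaryExtension_resolvent_eq [TopologicalSpace.SeparableSpace H]
    {F : ℂ → H →L[ℂ] H} (hF : DifferentiableOn ℂ F (Metric.ball 0 1)) (h0 : F 0 = 1)
    (hpos : ∀ z, ‖z‖ < 1 → 1 ≤ F z + star (F z)) :
    ∃ W : UnitaryExtension (⊥ : H →ₗ.[ℂ] H), ∀ ζ : 𝔻, W.resolvent (discPoint ζ) = F ζ := by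
  obtain ⟨a, ha0, hsum⟩ : ∃ a : ℕ → H →L[ℂ] H, a 0 = 1 ∧
      ∀ z, ‖z‖ < 1 → HasSum (fun n => z ^ n • a n) (F z) := by
    refine ⟨fun n => (n.factorial : ℂ)⁻¹ • iteratedDeriv n F 0, by simp [h0], fun z hz => ?_⟩
    simpa only [sub_zero, smul_comm (z ^ _)] using
      hasSum_taylorSeries_on_ball hF (z := z) (by simpa using hz)
  have hle (z : ℂ) (hz : ‖z‖ < 1) : a 0 ≤ F z + star (F z) := ha0.trans_le (hpos z hz)
  have hc := posSemidef_circulant_hermitianExtension hsum hle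
  obtain ⟨W, hW⟩ := exists_unitaryExtension_compression_pow hc ha0
  refine ⟨W, fun ζ => HasSum.unique ?_ (hsum ζ ζ.norm_lt_one)⟩
  have hnorm : ‖(ζ : ℂ) • (W.U : W.K →L[ℂ] W.K)‖ < 1 := by
    rw [norm_smul]
    exact (mul_le_of_le_one_right (norm_nonneg _) (norm_coe_linearIsometryEquiv_le W.U)).trans_lt
      ζ.norm_lt_one
  rw [W.resolvent_eq_compression, coe_discPoint]
  simpa only [smul_pow, map_smul, hW, hermitianExtension_natCast] using
    (compression W.J).hasSum (hasSum_geom_series_inverse _ hnorm)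

theorem eq_apply_of_adjoint_apply_eq {K : Type*} [NormedAddCommGroup K] [InnerProductSpace ℂ K]
    [CompleteSpace K] (J : H →ₗᵢ[ℂ] K) {w : K} {y : H} (h : (J.toContinuousLinearMap†) w = y)
    (hnorm : ‖w‖ = ‖y‖) : w = J y := by
  have hsq := norm_sq_eq_adjoint_add_rangeComplementProjection J w
  rw [h, hnorm, left_eq_add, sq_eq_zero_iff, norm_eq_zero, rangeComplementProjection_apply, h,
    sub_eq_zero] at hsq
  exact hsq

theorem exists_unitaryExtension_resolvent_eq_inverse [TopologicalSpace.SeparableSpace H]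
    (hV : IsIsometric V) {S : ℂ → H →L[ℂ] H} (hS : AnalyticOnNhd ℂ S (Metric.ball 0 1))
    (hnorm : ∀ z, ‖z‖ < 1 → ‖S z‖ ≤ 1) (hSV : ∀ x : V.domain, S 0 x = V x) :
    ∃ W : UnitaryExtension V, ∀ ζ : 𝔻,
      W.resolvent (discPoint ζ) = Ring.inverse (1 - (ζ : ℂ) • S ζ) := by
  have hunit (z : ℂ) (hz : ‖z‖ < 1) : IsUnit (1 - z • S z) := isUnit_one_sub_smul (hnorm z hz) hz
  have hF : DifferentiableOn ℂ (fun z => Ring.inverse (1 - z • S z)) (Metric.ball 0 1) :=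
    fun z hz => (analyticAt_ringInverse_comp (analyticAt_const.sub (analyticAt_id.smul (hS z hz)))
      (hunit z (by simpa using hz))).differentiableAt.differentiableWithinAt
  obtain ⟨W, hW⟩ := exists_unitaryExtension_resolvent_eq hF (by simp) fun z hz =>
    one_le_inverse_one_sub_add_star
      (by simpa [norm_smul] using mul_le_one₀ hz.le (norm_nonneg _) (hnorm z hz)) (hunit z hz)
  have hU : S 0 = compression W.J W.U := by
    have h0 : (0 : ℂ) ∈ Metric.ball 0 1 := by simp
    have hΘ := analyticOnNhd_transferFunction W.J (norm_coe_linearIsometryEquiv_le W.U)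
    refine ((hasDerivAt_inverse_one_sub_smul (hS 0 h0).differentiableAt).unique <|
      (hasDerivAt_inverse_one_sub_smul
        (hΘ 0 h0).differentiableAt).congr_of_eventuallyEq ?_).trans ?_
    · filter_upwards [Metric.ball_mem_nhds (0 : ℂ) one_pos] with z hz
      have hz : ‖z‖ < 1 := by simpa using hz
      exact (hW (.mk z hz)).symm.trans (W.resolvent_discPoint (.mk z hz))
    · simp [transferFunction]
  refine ⟨⟨W.K, W.J, W.U, fun x => eq_apply_of_adjoint_apply_eq W.J ?_ ?_⟩, hW⟩
  · rw [← hSV, hU, compression_apply]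
    rfl
  · rw [W.U.norm_map, W.J.norm_map, hV]

end Realization

section Graph

variable {H : Type*} [NormedAddCommGroup H] [InnerProductSpace ℂ H] {T : H →ₗ.[ℂ] H} {z : ℂ}
  {a b : H}

theorem mem_graph_toPMap_top {f : H →ₗ[ℂ] H} : (a, b) ∈ (f.toPMap ⊤).graph ↔ b = f a := by
  simp [LinearPMap.mem_graph_iff, eq_comm]

theorem mem_graph_E_sub_smul :
    (a, b) ∈ (E H - z • T).graph ↔ ∃ w, (a, w) ∈ T.graph ∧ b = a - z • w := by
  simp only [LinearPMap.mem_graph_iff]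
  constructor
  · rintro ⟨x, rfl, rfl⟩
    exact ⟨_, ⟨⟨x, x.2.2⟩, rfl, rfl⟩, rfl⟩
  · rintro ⟨_, ⟨x, rfl, rfl⟩, rfl⟩
    exact ⟨⟨x, trivial, x.2⟩, rfl, rfl⟩

theorem mem_graph_sub_smul_E :
    (a, b) ∈ (T - z • E H).graph ↔ ∃ w, (a, w) ∈ T.graph ∧ b = w - z • a := by
  simp only [LinearPMap.mem_graph_iff]
  constructor
  · rintro ⟨x, rfl, rfl⟩
    exact ⟨_, ⟨⟨x, x.2.1⟩, rfl, rfl⟩, rfl⟩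
  · rintro ⟨_, ⟨x, rfl, rfl⟩, rfl⟩
    exact ⟨⟨x, x.2, trivial⟩, rfl, rfl⟩

theorem mem_graph_product {S : H →ₗ.[ℂ] H} :
    (a, b) ∈ (product S T).graph ↔ ∃ c, (a, c) ∈ T.graph ∧ (c, b) ∈ S.graph := by
  have product_apply (x : (product S T).domain) (y : T.domain) (hy : (y : H) = x)
      (h : T y ∈ S.domain) : product S T x = S ⟨T y, h⟩ :=
    congrArg S (Subtype.ext (LinearPMap.domRestrict_apply hy.symm))
  simp only [LinearPMap.mem_graph_iff]
  constructor
  · rintro ⟨x, rfl, rfl⟩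
    obtain ⟨y, hy, hyx⟩ := x.2.1
    exact ⟨T y, ⟨y, hyx, rfl⟩, ⟨T y, hy⟩, rfl, (product_apply x y hyx hy).symm⟩
  · rintro ⟨_, ⟨x, rfl, rfl⟩, ⟨y, hy, rfl⟩⟩
    have hx : T x ∈ S.domain := hy ▸ y.2
    refine ⟨⟨x, ⟨x, hx, rfl⟩, x.2⟩, rfl, ?_⟩
    rw [product_apply _ x rfl hx]
    exact congrArg S (Subtype.ext hy.symm)

theorem ker_E_sub_smul_eq_bot_iff :
    LinearMap.ker (E H - z • T).toFun = ⊥ ↔ ∀ x w, (x, w) ∈ T.graph → x = z • w → x = 0 := by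
  rw [LinearMap.ker_eq_bot']
  constructor
  · intro h x w hw hxw
    obtain ⟨y, rfl, hy⟩ := (LinearPMap.mem_graph_iff _).mp
      (mem_graph_E_sub_smul.mpr ⟨w, hw, (sub_eq_zero.mpr hxw).symm⟩)
    exact congrArg Subtype.val (h y hy)
  · intro h x hx
    obtain ⟨w, hw, hxw⟩ := mem_graph_E_sub_smul.mp ((LinearPMap.mem_graph_iff _).mpr ⟨x, rfl, hx⟩)
    exact Subtype.ext (h x w hw (sub_eq_zero.mp hxw.symm))

theorem mem_graph_moebius (hT : LinearMap.ker (E H - z • T).toFun = ⊥) :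
    (a, b) ∈ (moebius z T).graph ↔
      ∃ x w, (x, w) ∈ T.graph ∧ a = x - z • w ∧ b = w - conj z • x := by
  have hinverse (c : H) : (a, c) ∈ (E H - z • T).inverse.graph ↔ (c, a) ∈ (E H - z • T).graph := by
    rw [LinearPMap.inverse_graph hT]
    simp
  simp only [moebius, mem_graph_product, hinverse, mem_graph_E_sub_smul, mem_graph_sub_smul_E]
  constructor
  · rintro ⟨x, ⟨w, hw, rfl⟩, w', hw', rfl⟩
    obtain rfl := T.mem_graph_snd_inj hw hw' rfl
    exact ⟨_, _, hw, rfl, rfl⟩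
  · rintro ⟨x, w, hw, rfl, rfl⟩
    exact ⟨x, ⟨w, hw, rfl⟩, w, hw, rfl⟩

theorem ker_E_sub_neg_smul_moebius (hz : ‖z‖ ≠ 1) (hT : LinearMap.ker (E H - z • T).toFun = ⊥) :
    LinearMap.ker (E H - (-z) • moebius z T).toFun = ⊥ := by
  refine ker_E_sub_smul_eq_bot_iff.mpr fun a b hab h => ?_
  obtain ⟨x, w, hw, rfl, rfl⟩ := (mem_graph_moebius hT).mp hab
  have hx : (1 - (‖z‖ : ℂ) ^ 2) • x = 0 := by
    rw [← sub_eq_zero.mpr h, ← conj_mul']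
    module
  obtain rfl := (smul_eq_zero_iff_right (one_sub_norm_sq_ne_zero hz)).mp hx
  obtain rfl := T.graph_fst_eq_zero_snd hw rfl
  simp only [smul_zero, sub_zero]

theorem moebius_neg_moebius (hz : ‖z‖ ≠ 1) (hT : LinearMap.ker (E H - z • T).toFun = ⊥) :
    moebius (-z) (moebius z T) = T := by
  have hscalar := one_sub_norm_sq_ne_zero hz
  refine LinearPMap.eq_of_eq_graph (Submodule.ext (Prod.forall.mpr fun a b => ?_))
  simp only [mem_graph_moebius (ker_E_sub_neg_smul_moebius hz hT),
    mem_graph_moebius hT, map_neg]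
  constructor
  · rintro ⟨_, _, ⟨x, w, hw, rfl, rfl⟩, ha, hb⟩
    convert T.graph.smul_mem (1 - (‖z‖ : ℂ) ^ 2) hw using 1
    refine Prod.ext (ha.trans ?_) (hb.trans ?_) <;>
    · simp only [Prod.smul_mk, ← conj_mul']
      module
  · intro hp
    refine ⟨_, _, ⟨_, _, T.graph.smul_mem (1 - (‖z‖ : ℂ) ^ 2)⁻¹ hp, rfl, rfl⟩, ?_, ?_⟩ <;>
    · simp only [← conj_mul'] at hscalar ⊢
      match_scalars <;> field_simp
      ring

theorem moebius_toPMap {A : H →L[ℂ] H} (h : IsUnit (1 - z • A)) :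
    moebius z (A.toLinearMap.toPMap ⊤) = (moebiusTransform z A).toLinearMap.toPMap ⊤ := by
  have hker : LinearMap.ker (E H - z • A.toLinearMap.toPMap ⊤).toFun = ⊥ := by
    refine ker_E_sub_smul_eq_bot_iff.mpr fun x w hw hxw => ?_
    rw [mem_graph_toPMap_top.mp hw] at hxw
    calc x = Ring.inverse (1 - z • A) (x - z • A x) :=
          congr($(Ring.inverse_mul_cancel _ h) x).symm
      _ = 0 := (congrArg _ (sub_eq_zero.mpr hxw)).trans (map_zero _)
  refine LinearPMap.eq_of_eq_graph (Submodule.ext (Prod.forall.mpr fun a b => ?_))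
  simp only [mem_graph_moebius hker, mem_graph_toPMap_top]
  constructor
  · rintro ⟨x, _, rfl, ha, hb⟩
    rw [ha, hb]
    exact congr($(moebiusTransform_mul_one_sub_smul h) x).symm
  · intro hp
    refine ⟨Ring.inverse (1 - z • A) a, _, rfl, ?_, hp⟩
    exact congr($(Ring.mul_inverse_cancel _ h) a).symm

end Graph

section Isometric

variable {H : Type*} [NormedAddCommGroup H] [InnerProductSpace ℂ H] {V : H →ₗ.[ℂ] H} {z : ℂ}

theorem IsIsometric.norm_eq_of_mem_graph (hV : IsIsometric V) {x w : H} (h : (x, w) ∈ V.graph) :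
    ‖w‖ = ‖x‖ := by
  obtain ⟨y, rfl, rfl⟩ := (LinearPMap.mem_graph_iff V).mp h
  exact hV y

theorem abs_one_sub_norm_mul_norm_le {x w : H} (h : ‖w‖ = ‖x‖) (z : ℂ) :
    |1 - ‖z‖| * ‖x‖ ≤ ‖x - z • w‖ := by
  calc |1 - ‖z‖| * ‖x‖ = |‖x‖ - ‖z • w‖| := by
        rw [norm_smul, h, ← one_sub_mul, abs_mul, abs_norm]
    _ ≤ ‖x - z • w‖ := abs_norm_sub_norm_le _ _

theorem norm_sub_smul_sq_sub (a b : H) (z : ℂ) :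
    ‖a - z • b‖ ^ 2 - ‖b - conj z • a‖ ^ 2 = (1 - ‖z‖ ^ 2) * (‖a‖ ^ 2 - ‖b‖ ^ 2) := by
  have hre : RCLike.re (inner ℂ a (z • b)) = RCLike.re (inner ℂ b (conj z • a)) := by
    rw [← inner_conj_symm a, RCLike.conj_re, inner_smul_left, inner_smul_right]
  rw [norm_sub_sq (𝕜 := ℂ) a, norm_sub_sq (𝕜 := ℂ) b, hre, norm_smul, norm_smul, norm_conj]
  ring

theorem IsIsometric.ker_E_sub_smul (hV : IsIsometric V) (hz : ‖z‖ ≠ 1) :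
    LinearMap.ker (E H - z • V).toFun = ⊥ := by
  refine ker_E_sub_smul_eq_bot_iff.mpr fun x w hw hxw => norm_le_zero_iff.mp ?_
  have h := abs_one_sub_norm_mul_norm_le (hV.norm_eq_of_mem_graph hw) z
  rw [← hxw, sub_self, norm_zero] at h
  exact nonpos_of_mul_nonpos_right h (abs_pos.mpr (sub_ne_zero.mpr hz.symm))

theorem IsIsometric.moebius (hV : IsIsometric V) (hz : ‖z‖ ≠ 1) : IsIsometric (moebius z V) := by
  intro a
  obtain ⟨x, w, hw, ha, hb⟩ := (mem_graph_moebius (hV.ker_E_sub_smul hz)).mp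
    ((IsometricResolvent.moebius z V).mem_graph a)
  have h := norm_sub_smul_sq_sub x w z
  rw [hV.norm_eq_of_mem_graph hw, sub_self, mul_zero, sub_eq_zero] at h
  rw [ha, hb]
  exact ((sq_eq_sq₀ (norm_nonneg _) (norm_nonneg _)).mp h).symm

theorem mem_M_coe {a : H} :
    a ∈ M V (z : OnePoint ℂ) ↔ ∃ x w, (x, w) ∈ V.graph ∧ a = x - z • w := by
  change a ∈ Set.range (E H - z • V) ↔ _
  simp only [LinearPMap.mem_range_iff, mem_graph_E_sub_smul]

theorem mem_M_infty {a : H} : a ∈ M V ∞ ↔ ∃ x, (x, a) ∈ V.graph := by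
  change a ∈ Set.range V ↔ _
  rw [LinearPMap.mem_range_iff]

theorem mem_M_reflect {b : H} :
    b ∈ M V (reflect z) ↔ ∃ x w, (x, w) ∈ V.graph ∧ b = w - conj z • x := by
  by_cases hz : z = 0
  · simp [reflect, hz, mem_M_infty]
  · have hz' : conj z ≠ 0 := (map_ne_zero _).mpr hz
    rw [reflect, if_neg hz, mem_M_coe]
    constructor
    · rintro ⟨x, w, h, rfl⟩
      refine ⟨_, _, V.graph.smul_mem (-(conj z)⁻¹) h, ?_⟩
      match_scalars <;> field_simp
    · rintro ⟨x, w, h, rfl⟩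
      refine ⟨_, _, V.graph.smul_mem (-conj z) h, ?_⟩
      match_scalars <;> field_simp

theorem moebius_domain (hV : LinearMap.ker (E H - z • V).toFun = ⊥) :
    (moebius z V).domain = M V (z : OnePoint ℂ) := by
  ext a
  simp only [LinearPMap.mem_domain_iff, mem_M_coe, mem_graph_moebius hV]
  exact ⟨fun ⟨_, x, w, hw, ha, _⟩ => ⟨x, w, hw, ha⟩, fun ⟨x, w, hw, ha⟩ => ⟨_, x, w, hw, ha, rfl⟩⟩

theorem range_moebius (hV : LinearMap.ker (E H - z • V).toFun = ⊥) :
    LinearMap.range (moebius z V).toFun = M V (reflect z) := by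
  ext b
  change b ∈ Set.range (moebius z V) ↔ _
  simp only [LinearPMap.mem_range_iff, mem_M_reflect, mem_graph_moebius hV]
  exact ⟨fun ⟨_, x, w, hw, _, hb⟩ => ⟨x, w, hw, hb⟩, fun ⟨x, w, hw, hb⟩ => ⟨_, x, w, hw, rfl, hb⟩⟩

theorem isClosed_M [CompleteSpace H] (hV : IsIsometric V) (hclosed : V.IsClosed) (hz : ‖z‖ ≠ 1) :
    IsClosed (M V (z : OnePoint ℂ) : Set H) := by
  have : CompleteSpace V.graph := completeSpace_coe_iff_isComplete.mpr (IsClosed.isComplete hclosed)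
  let f : V.graph →L[ℂ] H :=
    (ContinuousLinearMap.fst ℂ H H - z • ContinuousLinearMap.snd ℂ H H) ∘L V.graph.subtypeL
  have hpos : 0 < |1 - ‖z‖| := abs_pos.mpr (sub_ne_zero.mpr hz.symm)
  have hanti : AntilipschitzWith (Real.toNNReal |1 - ‖z‖|⁻¹) f := by
    refine AddMonoidHomClass.antilipschitz_of_bound f fun p => ?_
    have hp : ‖p.1.2‖ = ‖p.1.1‖ := hV.norm_eq_of_mem_graph p.2
    have hnorm : ‖p‖ = ‖p.1.1‖ := (congrArg (max ‖p.1.1‖) hp).trans (max_self _)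
    rw [Real.coe_toNNReal _ (inv_nonneg.mpr hpos.le), hnorm, le_inv_mul_iff₀ hpos]
    exact abs_one_sub_norm_mul_norm_le hp z
  convert hanti.isClosed_range f.uniformContinuous using 1
  ext a
  rw [SetLike.mem_coe, mem_M_coe]
  exact ⟨fun ⟨x, w, hw, ha⟩ => ⟨⟨(x, w), hw⟩, ha.symm⟩, fun ⟨p, hp⟩ => ⟨p.1.1, p.1.2, p.2, hp.symm⟩⟩

end Isometric

section GeneralizedResolvent

variable {H : Type*} [NormedAddCommGroup H] [InnerProductSpace ℂ H] {V V' : H →ₗ.[ℂ] H}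

theorem UnitaryExtension.apply_of_mem_graph (W : UnitaryExtension V) {x w : H}
    (h : (x, w) ∈ V.graph) : W.U (W.J x) = W.J w := by
  obtain ⟨y, rfl, rfl⟩ := (LinearPMap.mem_graph_iff V).mp h
  exact W.extends_V y

theorem UnitaryExtension.isIsometric (W : UnitaryExtension V) : IsIsometric V := fun x => by
  rw [← W.J.norm_map, ← W.extends_V, W.U.norm_map, W.J.norm_map]

variable [CompleteSpace H] {W : UnitaryExtension V} {W' : UnitaryExtension V'}

theorem UnitaryExtension.resolvent_inv_conj (W : UnitaryExtension V) {z w : OffCircle}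
    (hz : (z : ℂ) ≠ 0) (hw : (w : ℂ) = (conj (z : ℂ))⁻¹) :
    W.resolvent w = 1 - star (W.resolvent z) := by
  have hU := coe_mem_unitary W.U
  have h := congrArg star (star_inverse_one_sub_inv_conj_smul hU hz
    (isUnit_one_sub_smul_of_mem_unitary hU z.2))
  rw [star_star, star_sub, star_one] at h
  rw [W.resolvent_eq_compression, W.resolvent_eq_compression, hw, h, map_sub, compression_one,
    compression_star]

theorem resolvent_eq_of_eqOn_disc
    (h : ∀ ζ : 𝔻, W.resolvent (discPoint ζ) = W'.resolvent (discPoint ζ)) :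
    W.resolvent = W'.resolvent := by
  funext ζ
  rcases lt_or_gt_of_ne ζ.2 with hζ | hζ
  · exact h (.mk ζ hζ)
  · have hlt : ‖(conj (ζ : ℂ))⁻¹‖ < 1 := by
      rw [norm_inv, norm_conj]
      exact inv_lt_one_of_one_lt₀ hζ
    have hne : (discPoint (.mk _ hlt) : ℂ) ≠ 0 :=
      inv_ne_zero ((map_ne_zero _).mpr (norm_pos_iff.mp (one_pos.trans hζ)))
    have hζ' : (ζ : ℂ) = (conj (discPoint (.mk _ hlt) : ℂ))⁻¹ := by simp [discPoint]
    rw [W.resolvent_inv_conj hne hζ', W'.resolvent_inv_conj hne hζ', h]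

theorem UnitaryExtension.continuousAt_compression_inverse (W : UnitaryExtension V) {z : ℂ}
    (hz : ‖z‖ ≠ 1) :
    ContinuousAt (fun w => compression W.J (Ring.inverse (1 - w • (W.U : W.K →L[ℂ] W.K)))) z :=
  (compression W.J).continuous.continuousAt.comp (analyticAt_ringInverse_comp
    (analyticAt_const.sub (analyticAt_id.smul analyticAt_const))
    (isUnit_one_sub_smul_of_mem_unitary (coe_mem_unitary W.U) hz)).continuousAt

theorem resolvent_eq_of_eqOn_compl_finite {s : Set ℂ} (hs : s.Finite)
    (h : ∀ ζ : OffCircle, (ζ : ℂ) ∉ s → W.resolvent ζ = W'.resolvent ζ) :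
    W.resolvent = W'.resolvent := by
  funext ζ
  have hoff : ∀ᶠ z : ℂ in 𝓝[≠] (ζ : ℂ), ‖z‖ ≠ 1 :=
    nhdsWithin_le_nhds (continuous_norm.continuousAt.eventually_ne ζ.2)
  refine tendsto_nhds_unique_of_eventuallyEq (l := 𝓝[≠] (ζ : ℂ))
    ((W.continuousAt_compression_inverse ζ.2).tendsto.mono_left nhdsWithin_le_nhds)
    ((W'.continuousAt_compression_inverse ζ.2).tendsto.mono_left nhdsWithin_le_nhds) ?_
  filter_upwards [nhdsNE_of_nhdsNE_sdiff_finite hoff hs] with z ⟨hz, hzs⟩ using h ⟨z, hz⟩ hzs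

end GeneralizedResolvent

section MoebiusRelation

variable {H : Type*} [NormedAddCommGroup H] [InnerProductSpace ℂ H] {V : H →ₗ.[ℂ] H}

/-- The unitary extension `(U - z̄) (1 - z U)⁻¹` of `V_z`, in the same space, that corresponds to a
unitary extension `U` of `V`. -/
def UnitaryExtension.moebius (W : UnitaryExtension V) (z : 𝔻) :
    UnitaryExtension (moebius z V) :=
  have hunit : IsUnit (1 - (z : ℂ) • (W.U : W.K →L[ℂ] W.K)) :=
    isUnit_one_sub_smul_of_mem_unitary (coe_mem_unitary W.U) z.norm_ne_one
  { K := W.K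
    J := W.J
    U := Unitary.linearIsometryEquiv
      ⟨moebiusTransform z (W.U : W.K →L[ℂ] W.K),
        moebiusTransform_mem_unitary (coe_mem_unitary W.U) hunit⟩
    extends_V a := by
      obtain ⟨x, w, hw, ha, hb⟩ := (mem_graph_moebius
        (W.isIsometric.ker_E_sub_smul z.norm_ne_one)).mp
        ((IsometricResolvent.moebius z V).mem_graph a)
      have happly := congr($(moebiusTransform_mul_one_sub_smul hunit) (W.J x))
      rw [ha, hb, W.J.map_sub, W.J.map_sub, W.J.map_smul, W.J.map_smul, ← W.apply_of_mem_graph hw]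
      exact happly }

variable {z : 𝔻} {R Q : OffCircle → H →L[ℂ] H}

theorem MoebiusRelation.symm (h : MoebiusRelation z R Q) : MoebiusRelation (-z) Q R := by
  intro t u ht htz hzt hut
  simp only [UnitDisc.coe_neg, map_neg, neg_mul, sub_neg_eq_add, norm_neg, neg_neg,
    mul_comm (conj (z : ℂ)) (t : ℂ)]
    at htz hzt hut ⊢
  have hscalar := one_sub_norm_sq_ne_zero z.norm_ne_one
  have htz' : (t : ℂ) + z ≠ 0 := fun h0 => htz (eq_neg_of_add_eq_zero_left h0)
  have hsub : (u : ℂ) - z = (1 - (‖(z : ℂ)‖ : ℂ) ^ 2) * t / (1 + t * conj (z : ℂ)) := by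
    rw [hut, ← conj_mul']
    field_simp
    ring
  have hone_sub : 1 - conj (z : ℂ) * u
      = (1 - (‖(z : ℂ)‖ : ℂ) ^ 2) / (1 + t * conj (z : ℂ)) := by
    rw [hut, ← conj_mul', mul_div_assoc', one_sub_div hzt]
    ring
  have hrel := h u t (hut ▸ div_ne_zero htz' hzt)
    (sub_ne_zero.mp (hsub ▸ div_ne_zero (mul_ne_zero hscalar ht) hzt))
    (hone_sub ▸ div_ne_zero hscalar hzt) (by rw [hsub, hone_sub]; field_simp)
  rw [hrel, hsub, hone_sub, hut]
  generalize 1 - (‖(z : ℂ)‖ : ℂ) ^ 2 = c at hscalar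
  generalize 1 + t * conj (z : ℂ) = d at hzt
  match_scalars <;> field_simp
  ring

theorem moebiusRelation_neg_iff : MoebiusRelation (-z) Q R ↔ MoebiusRelation z R Q :=
  ⟨fun h => neg_neg z ▸ h.symm, fun h => h.symm⟩

theorem norm_div_one_sub_conj_mul_ne_one {z u : ℂ} (hz : ‖z‖ ≠ 1) (hu : ‖u‖ ≠ 1)
    (hzu : 1 - conj z * u ≠ 0) : ‖(u - z) / (1 - conj z * u)‖ ≠ 1 := by
  intro h
  rw [norm_div, div_eq_one_iff_eq (norm_ne_zero_iff.mpr hzu)] at h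
  have hsq := norm_sub_smul_sq_sub (1 : ℂ) u (conj z)
  simp only [smul_eq_mul, mul_one, Complex.conj_conj, h, sub_self, norm_conj, norm_one,
    one_pow] at hsq
  have sq_ne {w : ℂ} (hw : ‖w‖ ≠ 1) : 1 - ‖w‖ ^ 2 ≠ 0 :=
    sub_ne_zero.mpr (Ne.symm (mt (pow_eq_one_iff_of_nonneg (norm_nonneg w) two_ne_zero).mp hw))
  exact mul_ne_zero (sq_ne hz) (sq_ne hu) hsq.symm

variable [CompleteSpace H]

theorem moebiusRelation_resolvent_moebius (W : UnitaryExtension V) (z : 𝔻) :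
    MoebiusRelation z W.resolvent (W.moebius z).resolvent := by
  intro u t _ huz hzu htu
  have hunit (w : OffCircle) := isUnit_one_sub_smul_of_mem_unitary (coe_mem_unitary W.U) w.2
  have hmoebius : IsUnit (1 - (t : ℂ) • moebiusTransform (z : ℂ) (W.U : W.K →L[ℂ] W.K)) :=
    isUnit_one_sub_smul_of_mem_unitary (coe_mem_unitary (W.moebius z).U) t.2
  rw [W.resolvent_eq_compression, inverse_one_sub_smul_eq z.norm_ne_one huz hzu htu
    (hunit (discPoint z)) (hunit u) hmoebius, map_add, map_smul, map_smul, compression_one]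
  rfl

theorem MoebiusRelation.resolvent_eq {W₁ W₂ : UnitaryExtension V}
    (h₁ : MoebiusRelation z W₁.resolvent Q) (h₂ : MoebiusRelation z W₂.resolvent Q) :
    W₁.resolvent = W₂.resolvent := by
  refine resolvent_eq_of_eqOn_compl_finite (s := {0, (z : ℂ), (conj (z : ℂ))⁻¹})
    (Set.toFinite _) fun u hu => ?_
  simp only [Set.mem_insert_iff, Set.mem_singleton_iff, not_or] at hu
  obtain ⟨hu0, huz, huz'⟩ := hu
  have hzu : 1 - conj (z : ℂ) * u ≠ 0 := fun h0 =>
    huz' (eq_inv_of_mul_eq_one_right (sub_eq_zero.mp h0).symm)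
  let t : OffCircle := ⟨_, norm_div_one_sub_conj_mul_ne_one z.norm_ne_one u.2 hzu⟩
  rw [h₁ u t hu0 huz hzu rfl, h₂ u t hu0 huz hzu rfl]

theorem existsUnique_moebiusRelation (z : 𝔻) (hR : R ∈ GeneralizedResolvents V) :
    ∃! Q, Q ∈ GeneralizedResolvents (moebius z V) ∧ MoebiusRelation z R Q := by
  obtain ⟨W, rfl⟩ := hR
  have hrel := moebiusRelation_resolvent_moebius W z
  refine ⟨_, ⟨⟨W.moebius z, rfl⟩, hrel⟩, ?_⟩
  rintro _ ⟨⟨W', rfl⟩, hrel'⟩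
  exact hrel'.symm.resolvent_eq hrel.symm

theorem existsUnique_moebiusRelation_symm (hV : IsIsometric V)
    (hQ : Q ∈ GeneralizedResolvents (moebius z V)) :
    ∃! R, R ∈ GeneralizedResolvents V ∧ MoebiusRelation z R Q := by
  have h := existsUnique_moebiusRelation (-z) hQ
  simp only [moebiusRelation_neg_iff, UnitDisc.coe_neg] at h
  rwa [moebius_neg_moebius z.norm_ne_one (hV.ker_E_sub_smul z.norm_ne_one)] at h

end MoebiusRelation

section Contraction

variable {H : Type*} [NormedAddCommGroup H] [InnerProductSpace ℂ H] {z : ℂ}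
  {S T : H →L[ℂ] H}

theorem moebiusTransform_apply_of_extends {V : H →ₗ.[ℂ] H}
    (hV : LinearMap.ker (E H - z • V).toFun = ⊥) (hS : IsUnit (1 - z • S))
    (hSV : ∀ x : V.domain, S x = V x) (a : (moebius z V).domain) :
    moebiusTransform z S a = moebius z V a := by
  obtain ⟨x, w, hxw, ha, hb⟩ := (mem_graph_moebius hV).mp ((moebius z V).mem_graph a)
  obtain ⟨y, rfl, rfl⟩ := (LinearPMap.mem_graph_iff V).mp hxw
  rw [ha, hb, ← hSV]
  exact congr($(moebiusTransform_mul_one_sub_smul hS) y)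

theorem isInverse_iff_eq_inverse {R : H →L[ℂ] H} (h : IsUnit (1 - z • S)) :
    IsInverse R (E H - z • S.toLinearMap.toPMap ⊤) ↔ R = Ring.inverse (1 - z • S) := by
  constructor
  · rintro ⟨-, hleft⟩
    rw [← one_mul (Ring.inverse _), Ring.eq_mul_inverse_iff_mul_eq _ _ _ h]
    ext x
    exact hleft ⟨x, trivial, trivial⟩
  · rintro rfl
    exact ⟨fun y => ⟨⟨trivial, trivial⟩, congr($(Ring.mul_inverse_cancel _ h) y)⟩,
      fun x => congr($(Ring.inverse_mul_cancel _ h) x)⟩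

variable [CompleteSpace H]

theorem norm_moebiusTransform_le (hz : ‖z‖ < 1) (hT : ‖T‖ ≤ 1) : ‖moebiusTransform z T‖ ≤ 1 := by
  have hunit := isUnit_one_sub_smul hT hz
  refine ContinuousLinearMap.opNorm_le_bound _ zero_le_one fun y => ?_
  obtain ⟨x, rfl⟩ : ∃ x, x - z • T x = y :=
    ⟨Ring.inverse (1 - z • T) y, congr($(Ring.mul_inverse_cancel _ hunit) y)⟩
  have happly : moebiusTransform z T (x - z • T x) = T x - conj z • x :=
    congr($(moebiusTransform_mul_one_sub_smul hunit) x)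
  have hTx : ‖T x‖ ≤ ‖x‖ := by simpa only [one_mul] using T.le_of_opNorm_le hT x
  rw [happly, one_mul, ← sq_le_sq₀ (norm_nonneg _) (norm_nonneg _), ← sub_nonneg,
    norm_sub_smul_sq_sub]
  refine mul_nonneg ?_ ?_
  · exact sub_nonneg.mpr (pow_le_one₀ (norm_nonneg z) hz.le)
  · exact sub_nonneg.mpr (by gcongr)

theorem analyticAt_moebiusTransform {F : ℂ → H →L[ℂ] H} {w : ℂ} (hz : ‖z‖ < 1)
    (hF : AnalyticAt ℂ F w) (hFw : ‖F w‖ ≤ 1) :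
    AnalyticAt ℂ (fun v => moebiusTransform z (F v)) w :=
  (hF.sub analyticAt_const).mul (analyticAt_ringInverse_comp
    (analyticAt_const.sub (hF.const_smul (c := z))) (isUnit_one_sub_smul hFw hz))

theorem adjoint_apply_apply_of_norm_eq (hT : ‖T‖ ≤ 1) {x : H} (hx : ‖T x‖ = ‖x‖) :
    ContinuousLinearMap.adjoint T (T x) = x := by
  have hle : ‖ContinuousLinearMap.adjoint T (T x)‖ ≤ ‖x‖ := by
    have hadjoint : ‖ContinuousLinearMap.adjoint T‖ ≤ 1 := by rwa [LinearIsometryEquiv.norm_map]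
    simpa only [one_mul, hx] using (ContinuousLinearMap.adjoint T).le_of_opNorm_le hadjoint (T x)
  have hsq : ‖ContinuousLinearMap.adjoint T (T x) - x‖ ^ 2 ≤ 0 := by
    rw [norm_sub_sq (𝕜 := ℂ), ContinuousLinearMap.adjoint_inner_left,
      inner_self_eq_norm_sq (𝕜 := ℂ), hx]
    linarith [pow_le_pow_left₀ (norm_nonneg _) hle 2]
  exact sub_eq_zero.mp (norm_eq_zero.mp (pow_eq_zero_iff two_ne_zero |>.mp
    (hsq.antisymm (sq_nonneg _))))

end Contraction

section DirectSum

variable {H : Type*} [NormedAddCommGroup H] [InnerProductSpace ℂ H] {K D R : Submodule ℂ H}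
  [K.HasOrthogonalProjection]

theorem exists_eq_add_coe (hD : D = Kᗮ) (y : H) : ∃ (x : K) (n : D), y = x + n := by
  obtain ⟨x, hx, n, hn, rfl⟩ := K.exists_add_mem_mem_orthogonal y
  exact ⟨⟨x, hx⟩, ⟨n, hD ▸ hn⟩, rfl⟩

variable [D.HasOrthogonalProjection] {A : K →ₗᵢ[ℂ] H}

/-- The operator `A ⊕ C` on the whole space, for an isometry `A` with domain `K` and an operator
`C` from `D = Kᗮ` to `R`. -/
def directSum (A : K →ₗᵢ[ℂ] H) (C : D →L[ℂ] R) : H →L[ℂ] H :=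
  A.toContinuousLinearMap ∘L K.orthogonalProjectionOnto
    + R.subtypeL ∘L C ∘L D.orthogonalProjectionOnto

theorem directSum_add (hD : D = Kᗮ) (C : D →L[ℂ] R) (x : K) (n : D) :
    directSum A C (x + n) = A x + C n := by
  have hn : (n : H) ∈ Kᗮ := hD ▸ n.2
  have hx : (x : H) ∈ Dᗮ := hD ▸ Submodule.le_orthogonal_orthogonal K x.2
  simp only [directSum, add_apply, ContinuousLinearMap.comp_apply,
    map_add K.orthogonalProjectionOnto, map_add D.orthogonalProjectionOnto,
    Submodule.orthogonalProjectionOnto_mem_subspace_eq_self,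
    Submodule.orthogonalProjectionOnto_apply_of_mem_orthogonal hn,
    Submodule.orthogonalProjectionOnto_apply_of_mem_orthogonal hx, add_zero, zero_add]
  rfl

theorem directSum_injective (hD : D = Kᗮ) :
    Function.Injective (directSum A : (D →L[ℂ] R) → H →L[ℂ] H) := by
  intro C C' h
  ext n
  have hn := congr($h ((0 : K) + n))
  rwa [directSum_add hD, directSum_add hD, map_zero, zero_add, zero_add] at hn

theorem sup_eq_directSum (hD : D = Kᗮ) (C : D →L[ℂ] R) (h) :
    LinearPMap.sup ⟨K, A.toLinearMap⟩ ⟨D, R.subtype ∘ₗ C.toLinearMap⟩ h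
      = (directSum A C).toLinearMap.toPMap ⊤ := by
  have htop : K ⊔ D = ⊤ := hD ▸ Submodule.sup_orthogonal_of_hasOrthogonalProjection
  refine LinearPMap.ext htop fun y hy _ => ?_
  obtain ⟨x, n, rfl⟩ := exists_eq_add_coe hD y
  exact (LinearPMap.sup_apply h x n ⟨_, hy⟩ rfl).trans (directSum_add hD C x n).symm

theorem norm_directSum_le (hD : D = Kᗮ) (hR : R ≤ (LinearMap.range A.toLinearMap)ᗮ)
    {C : D →L[ℂ] R} (hC : ‖C‖ ≤ 1) : ‖directSum A C‖ ≤ 1 := by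
  refine ContinuousLinearMap.opNorm_le_bound _ zero_le_one fun y => ?_
  obtain ⟨x, n, rfl⟩ := exists_eq_add_coe hD y
  have hdomain : inner ℂ (x : H) n = 0 :=
    Submodule.inner_right_of_mem_orthogonal x.2 (hD ▸ n.2)
  have hrange : inner ℂ (A x) (C n : H) = 0 :=
    Submodule.inner_right_of_mem_orthogonal (LinearMap.mem_range_self A.toLinearMap x)
      (hR (C n).2)
  have hCn : ‖(C n : H)‖ ≤ ‖(n : H)‖ := by
    simpa only [one_mul, Submodule.coe_norm] using C.le_of_opNorm_le hC n
  rw [directSum_add hD, one_mul, ← sq_le_sq₀ (norm_nonneg _) (norm_nonneg _), sq, sq,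
    norm_add_sq_eq_norm_sq_add_norm_sq_of_inner_eq_zero _ _ hdomain,
    norm_add_sq_eq_norm_sq_add_norm_sq_of_inner_eq_zero _ _ hrange, A.norm_map,
    Submodule.coe_norm x]
  gcongr

theorem directSum_compression_eq [CompleteSpace H] [R.HasOrthogonalProjection] (hD : D = Kᗮ)
    (hR : R = (LinearMap.range A.toLinearMap)ᗮ) {T : H →L[ℂ] H} (hT : ‖T‖ ≤ 1)
    (hTA : ∀ x : K, T x = A x) :
    directSum A (R.orthogonalProjectionOnto ∘L T ∘L D.subtypeL) = T := by
  have hmaps (n : D) : T n ∈ R := by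
    rw [hR, Submodule.mem_orthogonal]
    rintro _ ⟨x, rfl⟩
    have hx : ContinuousLinearMap.adjoint T (T x) = x :=
      adjoint_apply_apply_of_norm_eq hT (by rw [hTA, A.norm_map, Submodule.coe_norm])
    change inner ℂ (A x) _ = 0
    rw [← hTA, ← ContinuousLinearMap.adjoint_inner_left, hx]
    exact Submodule.inner_right_of_mem_orthogonal x.2 (hD ▸ n.2)
  ext y
  obtain ⟨x, n, rfl⟩ := exists_eq_add_coe hD y
  rw [directSum_add hD, map_add, hTA]
  exact congr(A x + ($(Submodule.orthogonalProjectionOnto_mem_subspace_eq_self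
    (⟨T n, hmaps n⟩ : R)) : H))

end DirectSum

theorem analyticAt_comp_comp {𝕜 F E₁ E₂ E₃ E₄ : Type*} [NontriviallyNormedField 𝕜]
    [NormedAddCommGroup F] [NormedSpace 𝕜 F] [NormedAddCommGroup E₁] [NormedSpace 𝕜 E₁]
    [NormedAddCommGroup E₂] [NormedSpace 𝕜 E₂] [NormedAddCommGroup E₃] [NormedSpace 𝕜 E₃]
    [NormedAddCommGroup E₄] [NormedSpace 𝕜 E₄] {f : F → E₂ →L[𝕜] E₃} {w : F}
    (hf : AnalyticAt 𝕜 f w) (A : E₃ →L[𝕜] E₄) (B : E₁ →L[𝕜] E₂) :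
    AnalyticAt 𝕜 (fun v => A ∘L f v ∘L B) w :=
  (((ContinuousLinearMap.compL 𝕜 E₁ E₃ E₄ A) ∘L
    (ContinuousLinearMap.compL 𝕜 E₁ E₂ E₃).flip B).analyticAt _).comp hf

section BoundedExtension

variable {H : Type*} [NormedAddCommGroup H] [InnerProductSpace ℂ H] {V : H →ₗ.[ℂ] H}

/-- An isometric operator as a linear isometry of its domain into the whole space. -/
def IsIsometric.toLinearIsometry (hV : IsIsometric V) : V.domain →ₗᵢ[ℂ] H :=
  ⟨V.toFun, hV⟩

variable {z : 𝔻}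

theorem N_eq_orthogonal_domain (hV : IsIsometric V) :
    N V (z : ℂ) = (moebius (z : ℂ) V).domainᗮ := by
  rw [moebius_domain (hV.ker_E_sub_smul z.norm_ne_one), N]

theorem N_reflect_eq_orthogonal_range (hV : IsIsometric V) :
    N V (reflect z) =
      (LinearMap.range (hV.moebius z.norm_ne_one).toLinearIsometry.toLinearMap)ᗮ :=
  congrArg Submodule.orthogonal (range_moebius (hV.ker_E_sub_smul z.norm_ne_one)).symm

variable [CompleteSpace H]

instance (ζ : OnePoint ℂ) : (N V ζ).HasOrthogonalProjection := by
  unfold N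
  infer_instance

theorem hasOrthogonalProjection_moebius_domain (hV : IsIsometric V) (hclosed : V.IsClosed)
    {z : ℂ} (hz : ‖z‖ ≠ 1) : (moebius z V).domain.HasOrthogonalProjection := by
  rw [moebius_domain (hV.ker_E_sub_smul hz)]
  have := (isClosed_M hV hclosed hz).completeSpace_coe
  infer_instance

/-- The contraction of `N_z` into `N_{1/z̄}` cut out by the transform `S_z` of a contractive
extension `S` of `V`. -/
def defectParameter (V : H →ₗ.[ℂ] H) (z : 𝔻) (S : H →L[ℂ] H) :
    N V (z : ℂ) →L[ℂ] N V (reflect z) :=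
  (N V (reflect z)).orthogonalProjectionOnto ∘L moebiusTransform (z : ℂ) S ∘L
    (N V (z : ℂ)).subtypeL

theorem norm_defectParameter_le {S : H →L[ℂ] H} (hS : ‖S‖ ≤ 1) :
    ‖defectParameter V z S‖ ≤ 1 :=
  (ContinuousLinearMap.opNorm_comp_le _ _).trans <|
    mul_le_one₀ (Submodule.orthogonalProjectionOnto_norm_le _) (norm_nonneg _) <|
      (ContinuousLinearMap.opNorm_comp_le _ _).trans <|
        mul_le_one₀ (norm_moebiusTransform_le z.norm_lt_one hS) (norm_nonneg _)
          (Submodule.norm_subtypeL_le _)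

theorem defectParameter_mem_schurClass {S : ℂ → H →L[ℂ] H}
    (hS : AnalyticOnNhd ℂ S (Metric.ball 0 1)) (hnorm : ∀ ζ, ‖ζ‖ < 1 → ‖S ζ‖ ≤ 1) :
    (fun ζ : 𝔻 => defectParameter V z (S ζ)) ∈ SchurClass (N V (z : ℂ)) (N V (reflect z)) :=
  ⟨⟨fun ζ => defectParameter V z (S ζ), fun ζ hζ => analyticAt_comp_comp
      (analyticAt_moebiusTransform z.norm_lt_one (hS ζ hζ) (hnorm ζ (mem_ball_zero_iff.mp hζ))) _ _,
    fun _ => rfl⟩, fun ζ => norm_defectParameter_le (hnorm ζ ζ.norm_lt_one)⟩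

variable [(moebius (z : ℂ) V).domain.HasOrthogonalProjection]

/-- The orthogonal extension `V_{C;z}` as an everywhere defined bounded operator. -/
def boundedExtension (hV : IsIsometric V) (C : N V (z : ℂ) →L[ℂ] N V (reflect z)) : H →L[ℂ] H :=
  moebiusTransform (-(z : ℂ)) (directSum (hV.moebius z.norm_ne_one).toLinearIsometry C)

variable (hV : IsIsometric V) {C C' : N V (z : ℂ) →L[ℂ] N V (reflect z)}
include hV

theorem norm_directSum_moebius_le (hC : ‖C‖ ≤ 1) :
    ‖directSum (hV.moebius z.norm_ne_one).toLinearIsometry C‖ ≤ 1 :=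
  norm_directSum_le (N_eq_orthogonal_domain hV) (N_reflect_eq_orthogonal_range hV).le hC

theorem isUnit_one_sub_neg_smul_directSum (hC : ‖C‖ ≤ 1) :
    IsUnit (1 - (-(z : ℂ)) • directSum (hV.moebius z.norm_ne_one).toLinearIsometry C) :=
  isUnit_one_sub_smul (norm_directSum_moebius_le hV hC) (norm_neg (z : ℂ) ▸ z.norm_lt_one)

theorem norm_boundedExtension_le (hC : ‖C‖ ≤ 1) : ‖boundedExtension hV C‖ ≤ 1 :=
  norm_moebiusTransform_le (norm_neg (z : ℂ) ▸ z.norm_lt_one) (norm_directSum_moebius_le hV hC)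

theorem orthogonalExtension_eq (hC : ‖C‖ ≤ 1) :
    orthogonalExtension V z C = (boundedExtension hV C).toLinearMap.toPMap ⊤ := by
  have hplus : plusExtension V z C
      = (directSum (hV.moebius z.norm_ne_one).toLinearIsometry C).toLinearMap.toPMap ⊤ :=
    sup_eq_directSum (A := (hV.moebius z.norm_ne_one).toLinearIsometry)
      (N_eq_orthogonal_domain hV) C _
  have hmoebius : orthogonalExtension V z C = moebius (-z) (plusExtension V z C) := by
    have sub_neg_smul (S T : H →ₗ.[ℂ] H) (c : ℂ) : S - (-c) • T = S + c • T :=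
      LinearPMap.ext rfl fun x _ _ => by
        rw [LinearPMap.sub_apply, LinearPMap.add_apply, LinearPMap.smul_apply,
          LinearPMap.smul_apply, neg_smul, sub_neg_eq_add]
    rw [moebius, map_neg, sub_neg_smul, sub_neg_smul, orthogonalExtension]
  rw [hmoebius, hplus, moebius_toPMap (isUnit_one_sub_neg_smul_directSum hV hC)]
  rfl

theorem boundedExtension_apply (hC : ‖C‖ ≤ 1) (x : V.domain) : boundedExtension hV C x = V x := by
  have hker := hV.ker_E_sub_smul z.norm_ne_one
  have hsum (a : (moebius (z : ℂ) V).domain) :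
      directSum (hV.moebius z.norm_ne_one).toLinearIsometry C a = moebius (z : ℂ) V a := by
    have h := directSum_add (A := (hV.moebius z.norm_ne_one).toLinearIsometry)
      (N_eq_orthogonal_domain hV) C a 0
    rwa [map_zero, ZeroMemClass.coe_zero, ZeroMemClass.coe_zero, add_zero, add_zero] at h
  have h := moebiusTransform_apply_of_extends (ker_E_sub_neg_smul_moebius z.norm_ne_one hker)
    (isUnit_one_sub_neg_smul_directSum hV hC) hsum
  rw [moebius_neg_moebius z.norm_ne_one hker] at h
  exact h x

theorem boundedExtension_inj (hC : ‖C‖ ≤ 1) (hC' : ‖C'‖ ≤ 1) :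
    boundedExtension hV C = boundedExtension hV C' ↔ C = C' := by
  refine ⟨fun h => ?_, congrArg _⟩
  have hz : ‖-(z : ℂ)‖ ≠ 1 := norm_neg (z : ℂ) ▸ z.norm_ne_one
  refine directSum_injective (A := (hV.moebius z.norm_ne_one).toLinearIsometry)
    (N_eq_orthogonal_domain hV) ?_
  rw [← moebiusTransform_neg_moebiusTransform hz (isUnit_one_sub_neg_smul_directSum hV hC),
    ← moebiusTransform_neg_moebiusTransform hz (isUnit_one_sub_neg_smul_directSum hV hC')]
  exact congrArg _ h

theorem boundedExtension_defectParameter {S : H →L[ℂ] H} (hS : ‖S‖ ≤ 1)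
    (hSV : ∀ x : V.domain, S x = V x) : boundedExtension hV (defectParameter V z S) = S := by
  have hunit := isUnit_one_sub_smul hS z.norm_lt_one
  rw [boundedExtension, defectParameter, directSum_compression_eq (N_eq_orthogonal_domain hV)
    (N_reflect_eq_orthogonal_range hV) (norm_moebiusTransform_le z.norm_lt_one hS)
    (moebiusTransform_apply_of_extends (hV.ker_E_sub_smul z.norm_ne_one) hunit hSV)]
  exact moebiusTransform_neg_moebiusTransform z.norm_ne_one hunit

theorem analyticAt_boundedExtension {G : ℂ → N V (z : ℂ) →L[ℂ] N V (reflect z)} {w : ℂ}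
    (hG : AnalyticAt ℂ G w) (hGw : ‖G w‖ ≤ 1) :
    AnalyticAt ℂ (fun v => boundedExtension hV (G v)) w :=
  analyticAt_moebiusTransform (norm_neg (z : ℂ) ▸ z.norm_lt_one)
    (analyticAt_const.add (analyticAt_comp_comp hG _ _)) (norm_directSum_moebius_le hV hGw)

end BoundedExtension

section Inin

variable {H : Type u} [NormedAddCommGroup H] [InnerProductSpace ℂ H]

theorem schurClass_ext {H₁ H₂ : Submodule ℂ H} {C C' : 𝔻 → H₁ →L[ℂ] H₂}
    (hC : C ∈ SchurClass H₁ H₂) (hC' : C' ∈ SchurClass H₁ H₂)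
    (h : ∀ ζ : 𝔻, (ζ : ℂ) ≠ 0 → C ζ = C' ζ) : C = C' := by
  obtain ⟨⟨G, hG, hGC⟩, -⟩ := hC
  obtain ⟨⟨G', hG', hGC'⟩, -⟩ := hC'
  have hball : (0 : ℂ) ∈ Metric.ball (0 : ℂ) 1 := Metric.mem_ball_self one_pos
  have hpunctured : G =ᶠ[𝓝[≠] 0] G' := by
    filter_upwards [nhdsWithin_le_nhds (Metric.isOpen_ball.mem_nhds hball), self_mem_nhdsWithin]
      with w hw hw0
    have hval := h (.mk w (mem_ball_zero_iff.mp hw)) hw0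
    rwa [← hGC, ← hGC'] at hval
  funext ζ
  by_cases hζ : (ζ : ℂ) = 0
  · rw [← hGC, ← hGC', hζ]
    exact tendsto_nhds_unique_of_eventuallyEq (l := 𝓝[≠] (0 : ℂ))
      ((hG 0 hball).continuousAt.tendsto.mono_left nhdsWithin_le_nhds)
      ((hG' 0 hball).continuousAt.tendsto.mono_left nhdsWithin_le_nhds) hpunctured
  · exact h ζ hζ

theorem eq_of_inverse_one_sub_smul_eq {A : Type*} [Ring A] [Algebra ℂ A] {a b : A} {ζ : ℂ}
    (hζ : ζ ≠ 0) (ha : IsUnit (1 - ζ • a)) (hb : IsUnit (1 - ζ • b))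
    (h : Ring.inverse (1 - ζ • a) = Ring.inverse (1 - ζ • b)) : a = b := by
  have hsub : 1 - ζ • a = 1 - ζ • b := by
    rw [← Ring.inverse_inverse ha, h, Ring.inverse_inverse hb]
  exact smul_right_injective A hζ (sub_right_injective hsub)

variable [CompleteSpace H] {V : H →ₗ.[ℂ] H} {z : 𝔻}

theorem ininFormula_iff [(moebius (z : ℂ) V).domain.HasOrthogonalProjection]
    (hV : IsIsometric V) {C : 𝔻 → N V (z : ℂ) →L[ℂ] N V (reflect z)} (hC : ∀ ζ, ‖C ζ‖ ≤ 1)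
    {R : OffCircle → H →L[ℂ] H} :
    IninFormula V z R C ↔
      ∀ ζ : 𝔻, R (discPoint ζ) = Ring.inverse (1 - (ζ : ℂ) • boundedExtension hV (C ζ)) := by
  refine forall_congr' fun ζ => ?_
  rw [orthogonalExtension_eq hV (hC ζ)]
  exact isInverse_iff_eq_inverse
    (isUnit_one_sub_smul (norm_boundedExtension_le hV (hC ζ)) ζ.norm_lt_one)

variable (hV : IsIsometric V) (hclosed : V.IsClosed)
include hV hclosed

theorem IninFormula.eq_of_mem_schurClass {C C' : 𝔻 → N V (z : ℂ) →L[ℂ] N V (reflect z)}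
    {R : OffCircle → H →L[ℂ] H} (h : IninFormula V z R C)
    (hC : C ∈ SchurClass (N V (z : ℂ)) (N V (reflect z)))
    (hC' : C' ∈ SchurClass (N V (z : ℂ)) (N V (reflect z))) (h' : IninFormula V z R C') :
    C = C' := by
  have := hasOrthogonalProjection_moebius_domain hV hclosed z.norm_ne_one
  rw [ininFormula_iff hV hC.2] at h
  rw [ininFormula_iff hV hC'.2] at h'
  refine schurClass_ext hC hC' fun ζ hζ => ?_
  have hunit {B : N V (z : ℂ) →L[ℂ] N V (reflect z)} (hB : ‖B‖ ≤ 1) :=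
    isUnit_one_sub_smul (norm_boundedExtension_le hV hB) ζ.norm_lt_one
  exact (boundedExtension_inj hV (hC.2 ζ) (hC'.2 ζ)).mp <| eq_of_inverse_one_sub_smul_eq hζ
    (hunit (hC.2 ζ)) (hunit (hC'.2 ζ)) ((h ζ).symm.trans (h' ζ))

theorem existsUnique_schurClass_ininFormula (z : 𝔻) {R : OffCircle → H →L[ℂ] H}
    (hR : R ∈ GeneralizedResolvents V) :
    ∃! C, C ∈ SchurClass (N V (z : ℂ)) (N V (reflect z)) ∧ IninFormula V z R C := by
  obtain ⟨W, rfl⟩ := hR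
  have := hasOrthogonalProjection_moebius_domain hV hclosed z.norm_ne_one
  let S : ℂ → H →L[ℂ] H := transferFunction W.J W.U
  have hU : ‖(W.U : W.K →L[ℂ] W.K)‖ ≤ 1 := norm_coe_linearIsometryEquiv_le W.U
  have hnorm (ζ : ℂ) (hζ : ‖ζ‖ < 1) : ‖S ζ‖ ≤ 1 := norm_transferFunction_le W.J hU hζ
  have hmem : (fun ζ : 𝔻 => defectParameter V z (S ζ)) ∈ SchurClass _ _ :=
    defectParameter_mem_schurClass (analyticOnNhd_transferFunction W.J hU) hnorm
  have hformula : IninFormula V z W.resolvent fun ζ => defectParameter V z (S ζ) := by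
    refine (ininFormula_iff hV hmem.2).mpr fun ζ => ?_
    rw [W.resolvent_discPoint, boundedExtension_defectParameter hV (hnorm ζ ζ.norm_lt_one)
      fun x => transferFunction_apply_of_apply_eq W.J hU ζ.norm_lt_one (W.extends_V x)]
  exact ⟨_, ⟨hmem, hformula⟩, fun C hC => hC.2.eq_of_mem_schurClass hV hclosed hC.1 hmem hformula⟩

theorem existsUnique_generalizedResolvent_ininFormula [TopologicalSpace.SeparableSpace H]
    {C : 𝔻 → N V (z : ℂ) →L[ℂ] N V (reflect z)}
    (hC : C ∈ SchurClass (N V (z : ℂ)) (N V (reflect z))) :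
    ∃! R, R ∈ GeneralizedResolvents V ∧ IninFormula V z R C := by
  have := hasOrthogonalProjection_moebius_domain hV hclosed z.norm_ne_one
  have hformula_iff (R) : IninFormula V z R C ↔ _ := ininFormula_iff hV hC.2
  obtain ⟨⟨G, hG, hGC⟩, hC1⟩ := id hC
  have hG1 (w : ℂ) (hw : ‖w‖ < 1) : ‖G w‖ ≤ 1 := hGC (.mk w hw) ▸ hC1 (.mk w hw)
  obtain ⟨W, hW⟩ := exists_unitaryExtension_resolvent_eq_inverse hV
    (S := fun w => boundedExtension hV (G w))
    (fun w hw => analyticAt_boundedExtension hV (hG w hw) (hG1 w (mem_ball_zero_iff.mp hw)))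
    (fun w hw => norm_boundedExtension_le hV (hG1 w hw))
    (boundedExtension_apply hV (hG1 0 (by simp)))
  have hWC (ζ : 𝔻) : W.resolvent (discPoint ζ)
      = Ring.inverse (1 - (ζ : ℂ) • boundedExtension hV (C ζ)) := by rw [hW, hGC]
  refine ⟨W.resolvent, ⟨⟨W, rfl⟩, (hformula_iff _).mpr hWC⟩, ?_⟩
  rintro _ ⟨⟨W', rfl⟩, h'⟩
  exact resolvent_eq_of_eqOn_disc fun ζ => ((hformula_iff _).mp h' ζ).trans (hWC ζ).symm

end Inin

end

end IsometricResolvent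

theorem mainTheorem4 {H : Type u} [NormedAddCommGroup H] [InnerProductSpace ℂ H]
    [CompleteSpace H] [TopologicalSpace.SeparableSpace H]
    (V : H →ₗ.[ℂ] H) (hclosed : V.IsClosed) (hisometric : IsometricResolvent.IsIsometric V)
    (z₀ : Complex.UnitDisc) :
    -- Inin's formula is a bijection between generalized resolvents and contractive functions
    ((∀ R ∈ IsometricResolvent.GeneralizedResolvents V,
        ∃! C, C ∈ IsometricResolvent.SchurClass (IsometricResolvent.N V (z₀ : ℂ))
            (IsometricResolvent.N V (IsometricResolvent.reflect z₀)) ∧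
          IsometricResolvent.IninFormula V z₀ R C) ∧
      (∀ C ∈ IsometricResolvent.SchurClass (IsometricResolvent.N V (z₀ : ℂ))
          (IsometricResolvent.N V (IsometricResolvent.reflect z₀)),
        ∃! R, R ∈ IsometricResolvent.GeneralizedResolvents V ∧
          IsometricResolvent.IninFormula V z₀ R C)) ∧
    -- the generalized resolvents of `V` and of `V_{z₀}` correspond bijectively
    ((∀ R ∈ IsometricResolvent.GeneralizedResolvents V,
        ∃! Q, Q ∈ IsometricResolvent.GeneralizedResolvents (IsometricResolvent.moebius z₀ V) ∧
          IsometricResolvent.MoebiusRelation z₀ R Q) ∧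
      (∀ Q ∈ IsometricResolvent.GeneralizedResolvents (IsometricResolvent.moebius z₀ V),
        ∃! R, R ∈ IsometricResolvent.GeneralizedResolvents V ∧
          IsometricResolvent.MoebiusRelation z₀ R Q)) := by
  exact ⟨⟨fun R hR =>
        IsometricResolvent.existsUnique_schurClass_ininFormula hisometric hclosed z₀ hR,
      fun C hC =>
        IsometricResolvent.existsUnique_generalizedResolvent_ininFormula hisometric hclosed hC⟩,
    fun R hR => IsometricResolvent.existsUnique_moebiusRelation z₀ hR,
    fun Q hQ => IsometricResolvent.existsUnique_moebiusRelation_symm hisometric hQ⟩
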